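/- Let $\mathbb{S}_m$ denote the group of permutations of $\{1,\dots,m\}$, $m\ge 0$, and let $N,C_1,C_2,\dots$ be independent variables. There is exactly one family of functions $w_{\mathfrak{gl}}:\mathbb{S}_m\to\mathbb{C}[N,C_1,C_2,\dots]$, $m=0,1,2,\dots$ (the universal $\mathfrak{gl}$-weight system), with the following three properties. (1) $w_{\mathfrak{gl}}$ is multiplicative: its value on the concatenation of two permutations is the product of its values on them. (2) $w_{\mathfrak{gl}}((1,2,\dots,m))=C_m$ for every $m\ge1$, where $(1,2,\dots,m)$ is the standard cycle $1\mapsto2\mapsto\dots\mapsto m\mapsto1$. (3) For $\alpha\in\mathbb{S}_m$ and $1\le k<m$, let $s=(k\;k{+}1)$ and $\beta=\alpha s$ (first $s$, then $\alpha$). For $j\in\{k,k+1\}$ let $\beta\setminus j\in\mathbb{S}_{m-1}$ be obtained from $\beta$ by deleting $j$ from its cycle (so that $\beta^{-1}(j)$ is now sent to $\beta(j)$ if $\beta(j)\ne j$) and renumbering the remaining elements in increasing order, and let $\varepsilon_j=N$ if $\beta(j)=j$ and $\varepsilon_j=1$ otherwise. Then $$w_{\mathfrak{gl}}(\alpha)-w_{\mathfrak{gl}}(s\alpha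 s)=\varepsilon_{k+1}\,w_{\mathfrak{gl}}(\beta\setminus (k{+}1))-\varepsilon_k\,w_{\mathfrak{gl}}(\beta\setminus k).$$ Let $S_1,S_2,\dots$ be further independent variables (the one-part Schur polynomials). The Schur substitution is the homomorphism of $\mathbb{C}[N]$-algebras $\Sigma:\mathbb{C}[N,C_1,C_2,\dots]\to\mathbb{C}[N,S_1,S_2,\dots]$ for which $\Sigma(C_k)$, $k\ge1$, is the coefficient of $u^{k+1}$ in the power series $$-\left(\frac{1-(N+1)u/2}{1-(N-1)u/2}\right)^{N}\frac{1+\sum_{i\ge1}S_i\left(\frac{u}{1-(N-1)u/2}\right)^i}{1+\sum_{i\ge1}S_i\left(\frac{u}{1-(N+1)u/2}\right)^i},$$ where the power with exponent $N$ is expanded by the binomial series. Then for every $m\ge0$ and every $\alpha\in\mathbb{S}_m$, the polynomial $\Sigma(w_{\mathfrak{gl}}(\alpha^{-1}))$ is obtained from $\Sigma(w_{\mathfrak{gl}}(\alpha))$ by substituting $S_i\mapsto(-1)^iS_i$, $i=1,2,3,\dots$ (with $N$ fixed), and multiplying by $(-1)^m$. -/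

import Mathlib

namespace UniversalGl

/-- The ring `ℂ[N][x₁, x₂, …]`. It plays the role of `ℂ[N, C₁, C₂, …]` (the variable `x_k` being
the Casimir `C_k`) and of `ℂ[N, S₁, S₂, …]` (the variable `x_k` being the one-part Schur
polynomial `S_k`). -/
abbrev PolyRing : Type := MvPolynomial ℕ+ (Polynomial ℂ)

/-- The element `N` of `ℂ[N][x₁, x₂, …]`. -/
noncomputable def N : PolyRing := MvPolynomial.C Polynomial.X

/-- Concatenation (connected sum) of permutations. -/
def concat {m n : ℕ} (α : Equiv.Perm (Fin m)) (β : Equiv.Perm (Fin n)) :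
    Equiv.Perm (Fin (m + n)) :=
  finSumFinEquiv.permCongr (Equiv.Perm.sumCongr α β)

/-- Delete the element `j` from the cycle of `β` containing it (so that the preimage of `j` is
now sent to the image of `j`) and renumber the remaining elements in increasing order. -/
def deletePoint {n : ℕ} (j : Fin (n + 1)) (β : Equiv.Perm (Fin (n + 1))) :
    Equiv.Perm (Fin n) :=
  Equiv.removeNone ((finSuccEquiv' j).permCongr β)

/-- A closed loop without vertices, which appears when the deleted element is a fixed point,
contributes a factor `N`. -/
noncomputable def loopFactor {n : ℕ} (j : Fin n) (β : Equiv.Perm (Fin n)) : PolyRing :=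
  if β j = j then N else 1

/-- The defining relations of the universal `𝔤𝔩`-weight system on permutations.

In `recurrence`, `s` is the transposition of two neighbouring elements `k, k + 1`. The permutation
`α * s` sends `k` to `α (k + 1)` and `k + 1` to `α k`. Deleting `k + 1` from it leaves one vertex
with incoming arrow from `α⁻¹ k` and outgoing arrow to `α (k + 1)`, and joins `α⁻¹ (k + 1)` to
`α k` by an arrow. Deleting `k` leaves one vertex with incoming arrow from `α⁻¹ (k + 1)` and
outgoing arrow to `α k`, and joins `α⁻¹ k` to `α (k + 1)`. If `α (k + 1) = k`, then `k` is a fixed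
point of `α * s`, which yields the factor `N` in the second term on the right, while in the first
term the remaining vertex is a fixed point, contributing `C₁`. -/
structure IsGlWeightSystem (w : (m : ℕ) → Equiv.Perm (Fin m) → PolyRing) : Prop where
  multiplicative : ∀ (m n : ℕ) (α : Equiv.Perm (Fin m)) (β : Equiv.Perm (Fin n)),
    w (m + n) (concat α β) = w m α * w n β
  cyclic : ∀ m : ℕ+, w m (finRotate m) = MvPolynomial.X m
  recurrence : ∀ (n : ℕ) (α : Equiv.Perm (Fin (n + 1))) (k : Fin n),
    let s : Equiv.Perm (Fin (n + 1)) := Equiv.swap k.castSucc k.succ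
    w (n + 1) α - w (n + 1) (s * α * s) =
      loopFactor k.succ (α * s) * w n (deletePoint k.succ (α * s)) -
        loopFactor k.castSucc (α * s) * w n (deletePoint k.castSucc (α * s))

/-- The series `1 / (1 - a u)`. -/
noncomputable def geometric (a : PolyRing) : PowerSeries PolyRing := PowerSeries.mk fun n => a ^ n

/-- The power `f ^ r` of a power series `f` with constant term `1`, with exponent `r` in the
coefficient ring, defined by the binomial series. -/
noncomputable def formalPow (f : PowerSeries PolyRing) (r : PolyRing) : PowerSeries PolyRing :=
  (PowerSeries.binomialSeries PolyRing r).subst (f - 1)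

/-- The series `1 + ∑_{k ≥ 1} S_k u ^ k`. -/
noncomputable def schurSeries : PowerSeries PolyRing :=
  PowerSeries.mk fun n => if h : 0 < n then MvPolynomial.X ⟨n, h⟩ else 1

/-- The series `1 + ∑_{k ≥ 1} S_k (u / (1 - a u)) ^ k`. -/
noncomputable def shiftedSchurSeries (a : PolyRing) : PowerSeries PolyRing :=
  schurSeries.subst (PowerSeries.X * geometric a)

/-- `(N - 1) / 2`. -/
noncomputable def halfPred : PolyRing := (1 / 2 : ℂ) • (N - 1)

/-- `(N + 1) / 2`. -/
noncomputable def halfSucc : PolyRing := (1 / 2 : ℂ) • (N + 1)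

/-- The series
`((1 - (N+1)u/2) / (1 - (N-1)u/2)) ^ N *
  (1 + ∑ S_i (u / (1 - (N-1)u/2)) ^ i) / (1 + ∑ S_i (u / (1 - (N+1)u/2)) ^ i)`,
which equals `1 - N u - ∑_{k ≥ 1} C_k u ^ (k + 1)` in terms of the Casimirs. -/
noncomputable def casimirSeries : PowerSeries PolyRing :=
  formalPow ((1 - PowerSeries.C halfSucc * PowerSeries.X) * geometric halfPred) N *
    (shiftedSchurSeries halfPred * PowerSeries.invOfUnit (shiftedSchurSeries halfSucc) 1)

/-- The Schur substitution `ℂ[N][C₁, C₂, …] → ℂ[N][S₁, S₂, …]`. -/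
noncomputable def schurSubstitution : PolyRing →ₐ[Polynomial ℂ] PolyRing :=
  MvPolynomial.aeval fun k : ℕ+ => -PowerSeries.coeff ((k : ℕ) + 1) casimirSeries

/-- The substitution `S_i ↦ (-1) ^ i S_i`. -/
noncomputable def signSubstitution : PolyRing →ₐ[Polynomial ℂ] PolyRing :=
  MvPolynomial.aeval fun i : ℕ+ => (-1) ^ (i : ℕ) * MvPolynomial.X i

end UniversalGl

/-! Existence and uniqueness. Adjacent transpositions conjugate any permutation of at least one
point to a concatenation ending in a standard cycle, and the recurrence expresses the effect of each
such conjugation through permutations of fewer points. So all weight systems, in any commutative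
`ℂ[N]`-algebra, are given by the same polynomials in their values at standard cycles
(`exists_poly`); this is uniqueness. For existence these polynomials must be shown to satisfy the
relations, which is tested in models.

The models are a version, with `N` a formal variable, of `𝔤𝔩_N` acting on a tensor power `V^{⊗r}`
twisted by a power of the determinant. By Schur–Weyl duality the matrix of generators in an
auxiliary slot `x` becomes `J_x = c + ∑_a (x a)`, with `a` running over `r` points. The weight of
`α` is the partial trace over the slots of `α ∏ J_x`, each closed loop counting `N`. The commutator
of `J_x` and `J_y` (`jm_commutator`) yields the recurrence (`weight_recurrence`). A leading
coefficient argument shows that the models for all `r` together separate polynomials in the Casimirs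
(`eq_zero_of_modelEval`), so an identity valid in every model holds universally.

Inversion. The family `α ↦ (-1)^m w(α⁻¹)` is again a weight system (`IsWeightSystem.inv`), so only
standard cycles need to be compared. In the models the inverse of the `k`-cycle has weight `D_k = tr
J^k`, while the `k`-cycle itself obeys a recursion in the `D_j` (`cycleTrace_cons`). With `D_0 = N`
and `F(u) = 1 - N u - ∑ C_k u^{k+1}` the recursion reads `(1 + ∑ D_k u^{k+1}) F(u/(1+Nu)) = 1`
(`mul_substHom_eq_one`). Let `E` be the Schur form of `F` and `E⁻` the result of `S_i ↦ (-1)^i S_i`.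
Then `E⁻(-u) E(u/(1+Nu)) = 1`, because `u ↦ u/(1+Nu)` followed by the sign change exchanges the
shifts `(N-1)/2` and `(N+1)/2`, whose sum is `N` (`negHom_map_mul_twistHom_casimirSeries`).
Comparing coefficients of the two inverses of `E(u/(1+Nu))` gives the theorem on cycles. -/

namespace UniversalGl

open Equiv

/-! ### Partial traces on the group algebra of permutations. -/

section PartialTrace

/-- The group algebra of the group of permutations of `T`. -/
abbrev PermAlg (R T : Type*) [CommRing R] := MonoidAlgebra R (Perm T)

variable {R T : Type*} [CommRing R]

/-- A permutation as an element of the group algebra. -/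
noncomputable def ofPerm (R : Type*) {T : Type*} [CommRing R] : Perm T →* PermAlg R T :=
  MonoidAlgebra.of R (Perm T)

theorem permAlg_induction {motive : PermAlg R T → Prop} (u : PermAlg R T)
    (of : ∀ π, motive (ofPerm R π)) (add : ∀ u v, motive u → motive v → motive (u + v))
    (smul : ∀ (r : R) u, motive u → motive (r • u)) : motive u :=
  MonoidAlgebra.induction_on u of add smul

/-- The subalgebra spanned by the permutations that fix all points outside `S`. -/
noncomputable def supp (R : Type*) {T : Type*} [CommRing R] (S : Set T) :
    Subalgebra R (PermAlg R T) :=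
  Algebra.adjoin R (ofPerm R '' {π | ∀ t ∉ S, π t = t})

theorem ofPerm_mem_supp {S : Set T} {π : Perm T} (h : ∀ t ∉ S, π t = t) :
    ofPerm R π ∈ supp R S :=
  Algebra.subset_adjoin ⟨π, h, rfl⟩

theorem supp_mono {S S' : Set T} (h : S ⊆ S') : supp R S ≤ supp R S' :=
  Algebra.adjoin_mono (Set.image_mono fun _ hπ t ht => hπ t fun hs => ht (h hs))

/-- The generating permutations already form a monoid, so their span is closed under products. This
is why `supp_induction` needs no multiplication case. -/
theorem supp_eq_span (S : Set T) : Subalgebra.toSubmodule (supp R S) =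
    Submodule.span R (ofPerm R '' {π : Perm T | ∀ t ∉ S, π t = t}) := by
  refine le_antisymm ?_ (Algebra.span_le_adjoin R _)
  rw [supp, Algebra.adjoin_eq_span]
  refine Submodule.span_mono ?_
  have : Submonoid.closure (ofPerm R '' {π : Perm T | ∀ t ∉ S, π t = t}) ≤
      Submonoid.map (ofPerm R)
        { carrier := {π : Perm T | ∀ t ∉ S, π t = t}
          one_mem' := fun _ _ => rfl
          mul_mem' := fun {a b} ha hb t ht => by
            rw [Perm.mul_apply, hb t ht, ha t ht] } :=
    Submonoid.closure_le.2 fun _ h => h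
  exact this

theorem mem_supp_iff {S : Set T} {u : PermAlg R T} : u ∈ supp R S ↔
    u ∈ Submodule.span R (ofPerm R '' {π : Perm T | ∀ t ∉ S, π t = t}) := by
  rw [← supp_eq_span, Subalgebra.mem_toSubmodule]

theorem supp_induction {S : Set T} {motive : (u : PermAlg R T) → u ∈ supp R S → Prop}
    (of : ∀ (π : Perm T) (hπ : ∀ t ∉ S, π t = t), motive (ofPerm R π) (ofPerm_mem_supp hπ))
    (add : ∀ u v hu hv, motive u hu → motive v hv → motive (u + v) (add_mem hu hv))
    (smul : ∀ (r : R) u hu, motive u hu → motive (r • u) (Subalgebra.smul_mem _ hu r))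
    {u : PermAlg R T} (hu : u ∈ supp R S) : motive u hu := by
  suffices ∃ h : u ∈ supp R S, motive u h from this.2
  have hspan : u ∈ Submodule.span R (ofPerm R '' {π : Perm T | ∀ t ∉ S, π t = t}) :=
    mem_supp_iff.1 hu
  induction hspan using Submodule.span_induction with
  | mem x hx => obtain ⟨π, hπ, rfl⟩ := hx; exact ⟨_, of π hπ⟩
  | zero =>
    exact ⟨zero_mem _, by simpa using smul 0 _ _ (of 1 fun _ _ => rfl)⟩
  | add x y hx hy h1 h2 =>
    obtain ⟨m1, h1⟩ := h1 (mem_supp_iff.2 hx)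
    obtain ⟨m2, h2⟩ := h2 (mem_supp_iff.2 hy)
    exact ⟨_, add _ _ m1 m2 h1 h2⟩
  | smul a x hx h1 =>
    obtain ⟨m1, h1⟩ := h1 (mem_supp_iff.2 hx)
    exact ⟨_, smul a _ m1 h1⟩

theorem commute_ofPerm_of_disjoint {S S' : Set T} (h : Disjoint S S') {π ρ : Perm T}
    (hπ : ∀ t ∉ S, π t = t) (hρ : ∀ t ∉ S', ρ t = t) : π * ρ = ρ * π := by
  refine Perm.Disjoint.commute fun t => ?_
  by_cases ht : t ∈ S
  · exact Or.inr (hρ t (Set.disjoint_left.1 h ht))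
  · exact Or.inl (hπ t ht)

theorem commute_of_disjoint {S S' : Set T} (h : Disjoint S S') {u v : PermAlg R T}
    (hu : u ∈ supp R S) (hv : v ∈ supp R S') : u * v = v * u := by
  induction hu using supp_induction with
  | add a b _ _ ha hb => rw [add_mul, mul_add, ha, hb]
  | smul r a _ ha => rw [smul_mul_assoc, mul_smul_comm, ha]
  | of π hπ =>
    induction hv using supp_induction with
    | add a b _ _ ha hb => rw [add_mul, mul_add, ha, hb]
    | smul r a _ ha => rw [smul_mul_assoc, mul_smul_comm, ha]
    | of ρ hρ => rw [← map_mul, ← map_mul, commute_ofPerm_of_disjoint h hπ hρ]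

/-- An element invariant under conjugation by the permutations supported in `S` commutes with
every element supported in `S`. -/
theorem commute_of_forall_conj {S : Set T} {u v : PermAlg R T} (hv : v ∈ supp R S)
    (hu : ∀ π : Perm T, (∀ t ∉ S, π t = t) → ofPerm R π * u = u * ofPerm R π) :
    v * u = u * v := by
  induction hv using supp_induction with
  | add a b _ _ ha hb => rw [add_mul, mul_add, ha, hb]
  | smul r a _ ha => rw [smul_mul_assoc, mul_smul_comm, ha]
  | of π hπ => exact hu π hπ

variable [DecidableEq T]

/-- Delete the point `x` from its cycle and make it a fixed point. -/
def isolate (x : T) (π : Perm T) : Perm T := swap x (π x) * π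

theorem isolate_apply (x : T) (π : Perm T) (t : T) :
    isolate x π t = if t = x then x else if π t = x then π x else π t := by
  have := π.injective.eq_iff (a := t) (b := x)
  simp only [isolate, Perm.mul_apply, swap_apply_def]
  split_ifs <;> simp_all

theorem isolate_of_fixed {x : T} {π : Perm T} (h : π x = x) : isolate x π = π := by
  rw [isolate, h, swap_self]; rfl

theorem isolate_mul_right (x : T) (π : Perm T) {ρ : Perm T} (h : ρ x = x) :
    isolate x (π * ρ) = isolate x π * ρ := by
  simp [isolate, h, mul_assoc]

theorem isolate_conj (σ : Perm T) (x : T) (π : Perm T) :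
    isolate (σ x) (σ * π * σ⁻¹) = σ * isolate x π * σ⁻¹ := by
  have : (σ * π * σ⁻¹) (σ x) = σ (π x) := by simp
  rw [isolate, isolate, this, swap_apply_apply]
  group

/-- Conjugating `π * ρ` by `ρ` gives `ρ * π`, so the left version follows from the right one and
equivariance. -/
theorem isolate_mul_left (x : T) (π : Perm T) {ρ : Perm T} (h : ρ x = x) :
    isolate x (ρ * π) = ρ * isolate x π := by
  have h1 := isolate_conj ρ x (π * ρ)
  have h2 : ρ⁻¹ x = x := by rw [Perm.inv_eq_iff_eq, h]
  rw [h, isolate_mul_right x π h] at h1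
  simpa [mul_assoc] using h1

theorem isolate_comm (x y : T) (π : Perm T) :
    isolate x (isolate y π) = isolate y (isolate x π) := by
  have inj := fun a b => π.injective.eq_iff (a := a) (b := b)
  ext t
  simp only [isolate_apply]
  grind

/-- The contribution of a deleted point: `ν` for a fixed point, `1` otherwise. -/
def loopWeight (ν : R) (x : T) (π : Perm T) : R := if π x = x then ν else 1

/-- The partial trace over the point `x`. -/
noncomputable def ptrace (ν : R) (x : T) : PermAlg R T →ₗ[R] PermAlg R T :=
  (MonoidAlgebra.basis (Perm T) R).constr R
    fun π => loopWeight ν x π • ofPerm R (isolate x π)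

theorem ptrace_ofPerm (ν : R) (x : T) (π : Perm T) :
    ptrace ν x (ofPerm R π) = loopWeight ν x π • ofPerm R (isolate x π) := by
  have : ofPerm R π = MonoidAlgebra.basis (Perm T) R π := by
    simp [ofPerm]
  rw [this, ptrace, Module.Basis.constr_basis]

theorem loopWeight_conj (ν : R) (σ : Perm T) (x : T) (π : Perm T) :
    loopWeight ν (σ x) (σ * π * σ⁻¹) = loopWeight ν x π := by
  simp [loopWeight]

theorem ptrace_conj (ν : R) (σ : Perm T) (x : T) (u : PermAlg R T) :
    ptrace ν (σ x) (ofPerm R σ * u * ofPerm R σ⁻¹) =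
      ofPerm R σ * ptrace ν x u * ofPerm R σ⁻¹ := by
  induction u using permAlg_induction with
  | of π =>
    rw [← map_mul, ← map_mul, ptrace_ofPerm, ptrace_ofPerm, loopWeight_conj, isolate_conj]
    simp only [map_mul, mul_smul_comm, smul_mul_assoc]
  | add u v hu hv => simp only [mul_add, add_mul, map_add, hu, hv]
  | smul r u hu => simp only [mul_smul_comm, smul_mul_assoc, map_smul, hu]

/-- The delicate case is a 2-cycle on `x` and `y`: in either order the first deletion contributes
`1` and leaves a loop, for which the second contributes `ν`. -/
theorem ptrace_comm (ν : R) (x y : T) (u : PermAlg R T) :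
    ptrace ν x (ptrace ν y u) = ptrace ν y (ptrace ν x u) := by
  induction u using permAlg_induction with
  | of π =>
    simp only [ptrace_ofPerm, map_smul, smul_smul, isolate_comm x y]
    congr 1
    have inj := fun a b => π.injective.eq_iff (a := a) (b := b)
    simp only [loopWeight, isolate_apply]
    grind
  | add u v hu hv => simp only [map_add, hu, hv]
  | smul r u hu => simp only [map_smul, hu]

/-- With `ptrace_mul_left`, this makes the partial trace over `x` a bimodule map over the elements
that do not touch `x`. -/
theorem ptrace_mul_right (ν : R) {x : T} (u : PermAlg R T) {v : PermAlg R T} {S : Set T}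
    (hv : v ∈ supp R S) (hx : x ∉ S) : ptrace ν x (u * v) = ptrace ν x u * v := by
  induction hv using supp_induction with
  | of ρ hρ =>
    induction u using permAlg_induction with
    | of π =>
      rw [← map_mul, ptrace_ofPerm, ptrace_ofPerm, isolate_mul_right _ _ (hρ x hx), map_mul,
        smul_mul_assoc]
      simp [loopWeight, hρ x hx]
    | add u v hu hv => simp only [add_mul, map_add, hu, hv]
    | smul r u hu => simp only [smul_mul_assoc, map_smul, hu]
  | add u v _ _ hu hv => simp only [mul_add, map_add, hu, hv]
  | smul r u _ hu => simp only [mul_smul_comm, map_smul, hu]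

theorem ptrace_mul_left (ν : R) {x : T} (u : PermAlg R T) {v : PermAlg R T} {S : Set T}
    (hv : v ∈ supp R S) (hx : x ∉ S) : ptrace ν x (v * u) = v * ptrace ν x u := by
  induction hv using supp_induction with
  | of ρ hρ =>
    induction u using permAlg_induction with
    | of π =>
      rw [← map_mul, ptrace_ofPerm, ptrace_ofPerm, isolate_mul_left _ _ (hρ x hx), map_mul,
        mul_smul_comm]
      have : ρ (π x) = x ↔ π x = x := by
        conv_lhs => rw [← hρ x hx, ρ.injective.eq_iff]
        simp [hρ x hx]
      simp [loopWeight, this]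
    | add u v hu hv => simp only [mul_add, map_add, hu, hv]
    | smul r u hu => simp only [mul_smul_comm, map_smul, hu]
  | add u v _ _ hu hv => simp only [add_mul, map_add, hu, hv]
  | smul r u _ hu => simp only [smul_mul_assoc, map_smul, hu]

theorem ptrace_of_mem_supp (ν : R) {x : T} {u : PermAlg R T} {S : Set T}
    (hu : u ∈ supp R S) (hx : x ∉ S) : ptrace ν x u = ν • u := by
  have h1 : ptrace ν x (1 : PermAlg R T) = ν • 1 := by
    have := ptrace_ofPerm ν x 1
    rwa [isolate_of_fixed rfl, map_one, loopWeight, if_pos (Perm.one_apply x)] at this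
  have := ptrace_mul_left ν 1 hu hx
  rwa [mul_one, h1, mul_smul_comm, mul_one] at this

theorem ptrace_mem_supp (ν : R) {x : T} {u : PermAlg R T} {S : Set T}
    (hu : u ∈ supp R S) : ptrace ν x u ∈ supp R (S \ {x}) := by
  induction hu using supp_induction with
  | of π hπ =>
    rw [ptrace_ofPerm]
    refine Subalgebra.smul_mem _ (ofPerm_mem_supp fun t ht => ?_) _
    rw [isolate_apply]
    by_cases htx : t = x
    · simp [htx]
    · have hts : t ∉ S := fun h => ht ⟨h, htx⟩
      simp [htx, hπ t hts]
  | add u v _ _ hu hv => rw [map_add]; exact add_mem hu hv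
  | smul r u _ hu => rw [map_smul]; exact Subalgebra.smul_mem _ hu _

theorem ptrace_swap (ν : R) {x y : T} (h : x ≠ y) : ptrace ν x (ofPerm R (swap x y)) = 1 := by
  rw [ptrace_ofPerm]
  simp [loopWeight, isolate, h.symm]

/-- The partial trace over a list of points. -/
noncomputable def ltrace (ν : R) (l : List T) (u : PermAlg R T) : PermAlg R T :=
  l.foldr (fun x v => ptrace ν x v) u

theorem ltrace_nil (ν : R) (u : PermAlg R T) : ltrace ν [] u = u := rfl

theorem ltrace_cons (ν : R) (x : T) (l : List T) (u : PermAlg R T) :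
    ltrace ν (x :: l) u = ptrace ν x (ltrace ν l u) := rfl

theorem ltrace_append (ν : R) (l l' : List T) (u : PermAlg R T) :
    ltrace ν (l ++ l') u = ltrace ν l (ltrace ν l' u) :=
  List.foldr_append

theorem ltrace_perm (ν : R) {l l' : List T} (h : l.Perm l') (u : PermAlg R T) :
    ltrace ν l u = ltrace ν l' u :=
  h.foldr_eq' (fun x _ y _ z => ptrace_comm ν y x z) u

theorem ltrace_cons' (ν : R) (x : T) (l : List T) (u : PermAlg R T) :
    ltrace ν (x :: l) u = ltrace ν l (ptrace ν x u) := by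
  rw [ltrace_perm ν (List.perm_append_singleton x l).symm, ltrace_append]
  rfl

theorem ltrace_add (ν : R) (l : List T) (u v : PermAlg R T) :
    ltrace ν l (u + v) = ltrace ν l u + ltrace ν l v := by
  induction l with
  | nil => rfl
  | cons x l ih => rw [ltrace_cons, ih, map_add]; rfl

theorem ltrace_smul (ν : R) (l : List T) (r : R) (u : PermAlg R T) :
    ltrace ν l (r • u) = r • ltrace ν l u := by
  induction l with
  | nil => rfl
  | cons x l ih => rw [ltrace_cons, ih, map_smul]; rfl

theorem ltrace_sub (ν : R) (l : List T) (u v : PermAlg R T) :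
    ltrace ν l (u - v) = ltrace ν l u - ltrace ν l v := by
  have := ltrace_add ν l (u - v) v
  rw [sub_add_cancel] at this
  rw [this, add_sub_cancel_right]

theorem ltrace_sum {ι : Type*} (ν : R) (l : List T) (s : Finset ι) (u : ι → PermAlg R T) :
    ltrace ν l (∑ i ∈ s, u i) = ∑ i ∈ s, ltrace ν l (u i) := by
  have h0 : ltrace ν l (0 : PermAlg R T) = 0 := by simpa using ltrace_sub ν l 0 0
  exact map_sum (AddMonoidHom.mk ⟨ltrace ν l, h0⟩ (ltrace_add ν l)) u s

theorem ltrace_mul_right (ν : R) {l : List T} (u : PermAlg R T) {v : PermAlg R T} {S : Set T}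
    (hv : v ∈ supp R S) (hl : ∀ x ∈ l, x ∉ S) : ltrace ν l (u * v) = ltrace ν l u * v := by
  induction l with
  | nil => rfl
  | cons x l ih =>
    rw [ltrace_cons, ih fun y hy => hl y (List.mem_cons_of_mem _ hy),
      ptrace_mul_right ν _ hv (hl x List.mem_cons_self), ltrace_cons]

theorem ltrace_mul_left (ν : R) {l : List T} (u : PermAlg R T) {v : PermAlg R T} {S : Set T}
    (hv : v ∈ supp R S) (hl : ∀ x ∈ l, x ∉ S) : ltrace ν l (v * u) = v * ltrace ν l u := by
  induction l with
  | nil => rfl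
  | cons x l ih =>
    rw [ltrace_cons, ih fun y hy => hl y (List.mem_cons_of_mem _ hy),
      ptrace_mul_left ν _ hv (hl x List.mem_cons_self), ltrace_cons]

theorem ltrace_mem_supp (ν : R) (l : List T) {u : PermAlg R T} {S : Set T}
    (hu : u ∈ supp R S) : ltrace ν l u ∈ supp R (S \ {x | x ∈ l}) := by
  induction l with
  | nil => simpa [ltrace_nil] using hu
  | cons x l ih =>
    refine supp_mono ?_ (ptrace_mem_supp ν ih)
    rintro t ⟨⟨h1, h2⟩, h3⟩
    refine ⟨h1, fun h => ?_⟩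
    rcases List.mem_cons.1 h with h | h
    · exact h3 h
    · exact h2 h

theorem ltrace_conj (ν : R) (σ : Perm T) (l : List T) (u : PermAlg R T) :
    ltrace ν (l.map σ) (ofPerm R σ * u * ofPerm R σ⁻¹) =
      ofPerm R σ * ltrace ν l u * ofPerm R σ⁻¹ := by
  induction l with
  | nil => rfl
  | cons x l ih => rw [List.map_cons, ltrace_cons, ih, ptrace_conj]; rfl

/-- Cyclicity of the partial trace. -/
theorem ltrace_swap_conj (ν : R) {l : List T} (hl : l.Nodup) {x y : T} (hx : x ∈ l) (hy : y ∈ l)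
    (u : PermAlg R T) :
    ltrace ν l (ofPerm R (swap x y) * u * ofPerm R (swap x y)) = ltrace ν l u := by
  have hp : (l.map (swap x y)).Perm l := by
    rw [List.perm_ext_iff_of_nodup (hl.map (swap x y).injective) hl]
    intro t
    rw [List.mem_map]
    constructor
    · rintro ⟨s, hs, rfl⟩
      rw [swap_apply_def]
      split_ifs <;> assumption
    · intro ht
      refine ⟨swap x y t, ?_, swap_apply_self _ _ _⟩
      rw [swap_apply_def]
      split_ifs <;> assumption
  have h := ltrace_conj ν (swap x y) l u
  have hu : u ∈ supp R Set.univ := by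
    induction u using permAlg_induction with
    | of π => exact ofPerm_mem_supp fun t ht => absurd trivial ht
    | add a b ha hb =>
      exact add_mem (ha (ltrace_conj ν _ _ _)) (hb (ltrace_conj ν _ _ _))
    | smul r a ha => exact Subalgebra.smul_mem _ (ha (ltrace_conj ν _ _ _)) _
  have hs : ofPerm R (swap x y) ∈ supp R {t | t ∈ l} := ofPerm_mem_supp fun t ht =>
    swap_apply_of_ne_of_ne (fun h => ht (h ▸ hx)) (fun h => ht (h ▸ hy))
  rw [swap_inv, ltrace_perm ν hp] at h
  -- After tracing over `l` nothing acts on the points of `l`, so the transposition passes through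
  -- and meets its inverse.
  rw [h, commute_of_disjoint disjoint_sdiff_self_right hs (ltrace_mem_supp ν l hu), mul_assoc,
    ← map_mul, swap_mul_self, map_one, mul_one]

theorem ltrace_swap_mul (ν : R) {l : List T} (hl : l.Nodup) {x y : T} (hx : x ∈ l) (hy : y ∈ l)
    (u : PermAlg R T) :
    ltrace ν l (ofPerm R (swap x y) * u) = ltrace ν l (u * ofPerm R (swap x y)) := by
  rw [← ltrace_swap_conj ν hl hx hy (ofPerm R (swap x y) * u), ← mul_assoc, ← map_mul,
    swap_mul_self, map_one, one_mul]

end PartialTrace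

end UniversalGl

/-! ### Weights of permutations from Jucys–Murphy type elements, and their recurrence. -/

namespace UniversalGl

open Equiv

section Weight

variable {R T : Type*} [CommRing R] [DecidableEq T]

/-- The Jucys–Murphy type element `c + ∑_{a ∈ A} (x a)`. -/
noncomputable def jm (c : R) (A : Finset T) (x : T) : PermAlg R T :=
  algebraMap R _ c + ∑ a ∈ A, ofPerm R (swap x a)

theorem jm_mem_supp (c : R) (A : Finset T) {x : T} {S : Set T} (hx : x ∈ S) (hA : ↑A ⊆ S) :
    jm c A x ∈ supp R S := by
  refine add_mem (Subalgebra.algebraMap_mem _ _) (sum_mem fun a ha => ofPerm_mem_supp fun t ht =>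
    swap_apply_of_ne_of_ne (fun h => ht (h ▸ hx)) (fun h => ht (h ▸ hA ha)))

theorem ofPerm_mul_jm (c : R) {A : Finset T} (x : T) {σ : Perm T} (hσ : ∀ t, σ t ∈ A ↔ t ∈ A) :
    ofPerm R σ * jm c A x = jm c A (σ x) * ofPerm R σ := by
  rw [jm, jm, mul_add, add_mul, Algebra.commutes, Finset.mul_sum, Finset.sum_mul]
  congr 1
  refine Finset.sum_bij (fun a _ => σ a) (fun a ha => (hσ a).2 ha)
    (fun a _ b _ h => σ.injective h) (fun b hb => ⟨σ⁻¹ b, ?_, by simp⟩) fun a _ => ?_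
  · rw [← hσ]; simpa using hb
  · rw [← map_mul, ← map_mul, mul_swap_eq_swap_mul]

theorem jm_mul_ofPerm_swap (c : R) {A : Finset T} {x y : T} (hx : x ∉ A) (hy : y ∉ A) :
    ofPerm R (swap x y) * jm c A x = jm c A y * ofPerm R (swap x y) := by
  rw [ofPerm_mul_jm, swap_apply_left]
  intro t
  rw [swap_apply_def]
  split_ifs with h1 h2
  · subst h1; simp [hx, hy]
  · subst h2; simp [hx, hy]
  · rfl

/-- This is the commutation relation of `𝔤𝔩` in matrix form. The constant `c` is central and drops
out, transpositions through different points of `A` commute, and for a common point the two 3-cycles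
factor through `(x y)`. -/
theorem jm_commutator (c : R) {A : Finset T} {x y : T} (hxy : x ≠ y) (hx : x ∉ A) (hy : y ∉ A) :
    jm c A x * jm c A y - jm c A y * jm c A x =
      ofPerm R (swap x y) * (jm c A x - jm c A y) := by
  have h1 : ∀ u v : PermAlg R T, (algebraMap R _ c + u) * (algebraMap R _ c + v) -
      (algebraMap R _ c + v) * (algebraMap R _ c + u) = u * v - v * u := by
    intro u v
    rw [add_mul, add_mul, mul_add, mul_add, mul_add, mul_add, Algebra.commutes c u,
      Algebra.commutes c v]
    abel
  rw [jm, jm, h1, add_sub_add_left_eq_sub, Finset.sum_mul_sum, Finset.sum_mul_sum,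
    Finset.sum_comm (s := A) (t := A)
      (f := fun a b => ofPerm R (swap y a) * ofPerm R (swap x b)),
    ← Finset.sum_sub_distrib, ← Finset.sum_sub_distrib, Finset.mul_sum]
  refine Finset.sum_congr rfl fun a ha => ?_
  have hxa : x ≠ a := fun h => hx (h ▸ ha)
  have hya : y ≠ a := fun h => hy (h ▸ ha)
  rw [← Finset.sum_sub_distrib, Finset.sum_eq_single a]
  · rw [mul_sub, ← map_mul, ← map_mul, ← map_mul, ← map_mul]
    congr 2
    · rw [mul_swap_eq_swap_mul, swap_apply_of_ne_of_ne hxy.symm hya, swap_apply_right, swap_comm]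
    · rw [mul_swap_eq_swap_mul (swap x y), swap_apply_right, swap_apply_of_ne_of_ne hxa.symm
        hya.symm, mul_swap_eq_swap_mul, swap_apply_right, swap_apply_of_ne_of_ne hxy hxa,
        mul_swap_eq_swap_mul (swap x y), swap_apply_right, swap_apply_of_ne_of_ne hxa.symm
        hya.symm]
  · intro b hb hba
    have hxb : x ≠ b := fun h => hx (h ▸ hb)
    have hyb : y ≠ b := fun h => hy (h ▸ hb)
    rw [← map_mul, ← map_mul, mul_swap_eq_swap_mul, swap_apply_of_ne_of_ne hxy.symm hya,
      swap_apply_of_ne_of_ne hxb.symm hba, sub_self]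
  · exact fun h => absurd ha h

theorem jm_commutator' (c : R) {A : Finset T} {x y : T} (hxy : x ≠ y) (hx : x ∉ A) (hy : y ∉ A) :
    jm c A x * jm c A y = jm c A y * jm c A x + ofPerm R (swap x y) * jm c A x -
      jm c A x * ofPerm R (swap x y) := by
  have h1 := jm_commutator c hxy hx hy
  have h2 := jm_mul_ofPerm_swap c hy hx
  rw [swap_comm y x] at h2
  rw [mul_sub, h2, sub_eq_iff_eq_add] at h1
  rw [h1]
  abel

/-- The correction terms telescope: in the inductive step the two copies of `J_x (x y) J_x ^ k`
cancel. -/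
theorem jm_pow_commutator (c : R) {A : Finset T} {x y : T} (hxy : x ≠ y) (hx : x ∉ A)
    (hy : y ∉ A) (k : ℕ) :
    jm c A x ^ k * jm c A y = jm c A y * jm c A x ^ k + ofPerm R (swap x y) * jm c A x ^ k -
      jm c A x ^ k * ofPerm R (swap x y) := by
  induction k with
  | zero => simp
  | succ k ih =>
    rw [pow_succ', mul_assoc, ih, mul_sub, mul_add, ← mul_assoc, jm_commutator' c hxy hx hy]
    noncomm_ring

/-- The product of the elements `jm c A x` over a list. -/
noncomputable def jmProd (c : R) (A : Finset T) (l : List T) : PermAlg R T :=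
  (l.map (jm c A)).prod

theorem jmProd_cons (c : R) (A : Finset T) (x : T) (l : List T) :
    jmProd c A (x :: l) = jm c A x * jmProd c A l := by simp [jmProd]

theorem jmProd_append (c : R) (A : Finset T) (l l' : List T) :
    jmProd c A (l ++ l') = jmProd c A l * jmProd c A l' := by simp [jmProd]

theorem jmProd_mem_supp (c : R) (A : Finset T) {l : List T} {S : Set T} (hl : ∀ x ∈ l, x ∈ S)
    (hA : ↑A ⊆ S) : jmProd c A l ∈ supp R S := by
  refine list_prod_mem fun u hu => ?_
  obtain ⟨x, hx, rfl⟩ := List.mem_map.1 hu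
  exact jm_mem_supp c A (hl x hx) hA

theorem ofPerm_mul_jmProd (c : R) {A : Finset T} (l : List T) {σ : Perm T}
    (hσ : ∀ t, σ t ∈ A ↔ t ∈ A) :
    ofPerm R σ * jmProd c A l = jmProd c A (l.map σ) * ofPerm R σ := by
  induction l with
  | nil => simp [jmProd]
  | cons x l ih =>
    rw [List.map_cons, jmProd_cons, jmProd_cons, ← mul_assoc, ofPerm_mul_jm c x hσ, mul_assoc, ih,
      mul_assoc]

/-- The weight of a permutation of the labels `l`, an element of the group algebra of the
permutations of `A`. -/
noncomputable def weight (ν c : R) (A : Finset T) (l : List T) (π : Perm T) : PermAlg R T :=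
  ltrace ν l (ofPerm R π * jmProd c A l)

theorem weight_mem_supp (ν c : R) {A : Finset T} {l : List T} {π : Perm T}
    (hπ : ∀ t ∉ l, π t = t) : weight ν c A l π ∈ supp R (A : Set T) := by
  have h : ofPerm R π * jmProd c A l ∈ supp R ({t | t ∈ l} ∪ (A : Set T)) :=
    mul_mem (ofPerm_mem_supp fun t ht => hπ t fun h => ht (Or.inl h))
      (jmProd_mem_supp c A (fun x hx => Or.inl hx) Set.subset_union_right)
  refine supp_mono ?_ (ltrace_mem_supp ν l h)
  rintro t ⟨h1 | h1, h2⟩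
  · exact absurd h1 h2
  · exact h1

theorem weight_conj (ν c : R) {A : Finset T} (l : List T) (π : Perm T) {σ : Perm T}
    (hσ : ∀ t, σ t ∈ A ↔ t ∈ A) :
    weight ν c A (l.map σ) (σ * π * σ⁻¹) =
      ofPerm R σ * weight ν c A l π * ofPerm R σ⁻¹ := by
  rw [weight, weight, ← ltrace_conj]
  congr 1
  simp only [map_mul, mul_assoc]
  rw [ofPerm_mul_jmProd c (l.map σ) (σ := σ⁻¹) fun t => by rw [← hσ]; simp]
  simp

/-- The labels have been traced out, so their names do not matter: the weight lives on `A`, where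
`σ` is trivial, and conjugation by `σ` leaves it alone. -/
theorem weight_relabel (ν c : R) {A : Finset T} {l : List T} {π : Perm T} {σ : Perm T}
    (hπ : ∀ t ∉ l, π t = t) (hσ : ∀ t ∈ A, σ t = t) :
    weight ν c A (l.map σ) (σ * π * σ⁻¹) = weight ν c A l π := by
  have hσ' : ∀ t, σ t ∈ A ↔ t ∈ A := by
    refine fun t => ⟨fun h => ?_, fun h => by rwa [hσ t h]⟩
    have := hσ _ h
    rwa [σ.injective this] at h
  rw [weight_conj ν c l π hσ', commute_of_disjoint (S := (A : Set T)ᶜ) disjoint_compl_left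
    (ofPerm_mem_supp fun t ht => hσ t (by simpa using ht)) (weight_mem_supp ν c hπ), mul_assoc,
    ← map_mul, mul_inv_cancel, map_one, mul_one]

/-- `jm` is symmetric in the points of `A`, so a weight is invariant under permutations of `A`; the
other weight is a combination of such permutations. This is the model of the centrality of Casimirs.
-/
theorem weight_commute (ν c : R) {A : Finset T} {l l' : List T} {π π' : Perm T}
    (hl : ∀ x ∈ l, x ∉ A) (hπ : ∀ t ∉ l, π t = t) (hπ' : ∀ t ∉ l', π' t = t) :
    weight ν c A l' π' * weight ν c A l π = weight ν c A l π * weight ν c A l' π' := by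
  refine commute_of_forall_conj (weight_mem_supp ν c hπ') fun σ hσ => ?_
  have hσ' : ∀ t, σ t ∈ A ↔ t ∈ A := by
    intro t
    by_cases ht : t ∈ A
    · simp only [ht, iff_true]
      by_contra h
      have h1 := hσ _ h
      rw [σ.injective h1] at h
      exact h ht
    · rw [hσ t ht]
  have h1 : l.map σ = l := by
    conv_rhs => rw [← List.map_id l]
    exact List.map_congr_left fun x hx => hσ x (hl x hx)
  have h2 : σ * π = π * σ := commute_ofPerm_of_disjoint (S := (A : Set T)) (S' := {t | t ∈ l})
    (Set.disjoint_left.2 fun t ht ht' => hl t ht' ht) hσ hπ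
  have h3 := weight_conj ν c l π hσ'
  rw [h1, h2, mul_inv_cancel_right] at h3
  rw [h3, mul_assoc _ _ (ofPerm R σ), ← map_mul, inv_mul_cancel, map_one, mul_one, ← h3]

/-- The two blocks share only the points of `A`. Tracing over `l'` leaves the first block untouched,
and what remains of the second lies on `A` and leaves the trace over `l`. -/
theorem weight_append (ν c : R) {A : Finset T} {l l' : List T} {π π' : Perm T}
    (hl : ∀ x ∈ l, x ∉ A) (hl' : ∀ x ∈ l', x ∉ A) (hd : l.Disjoint l') (hπ : ∀ t ∉ l, π t = t)
    (hπ' : ∀ t ∉ l', π' t = t) :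
    weight ν c A (l ++ l') (π * π') = weight ν c A l π * weight ν c A l' π' := by
  have h1 : jmProd c A l * ofPerm R π' = ofPerm R π' * jmProd c A l := by
    refine commute_of_disjoint (S := {t | t ∈ l} ∪ ↑A) (S' := {t | t ∈ l'}) ?_
      (jmProd_mem_supp c A (fun x hx => Or.inl hx) Set.subset_union_right) (ofPerm_mem_supp hπ')
    refine Set.disjoint_left.2 ?_
    rintro t (ht | ht) ht'
    · exact hd ht ht'
    · exact hl' t ht' ht
  have h2 : ofPerm R (π * π') * jmProd c A (l ++ l') =
      (ofPerm R π * jmProd c A l) * (ofPerm R π' * jmProd c A l') := by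
    rw [jmProd_append, map_mul]
    simp only [mul_assoc]
    rw [← mul_assoc (ofPerm R π') (jmProd c A l), ← h1, mul_assoc]
  have h3 : ofPerm R π * jmProd c A l ∈ supp R ({t | t ∈ l} ∪ (A : Set T)) :=
    mul_mem (ofPerm_mem_supp fun t ht => hπ t fun h => ht (Or.inl h))
      (jmProd_mem_supp c A (fun x hx => Or.inl hx) Set.subset_union_right)
  have h4 : ∀ x ∈ l', x ∉ {t | t ∈ l} ∪ (A : Set T) := by
    rintro x hx (h | h)
    · exact hd h hx
    · exact hl' x hx h
  rw [weight, h2, ltrace_append, ltrace_mul_left ν _ h3 h4]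
  exact ltrace_mul_right ν _ (weight_mem_supp ν c hπ') hl

/-- By cyclicity of the trace, conjugating `π` by `(x y)` amounts to exchanging the neighbouring
factors `J_x` and `J_y`. The difference is thus a commutator, which `jm_commutator` replaces by `(x
y)` times single factors. In each resulting term one of the two labels carries no factor, and
tracing over it deletes it from `π * swap x y`. -/
theorem weight_recurrence (ν c : R) {A : Finset T} {l l' : List T} {x y : T}
    (hn : (l ++ x :: y :: l').Nodup) (hA : ∀ z ∈ l ++ x :: y :: l', z ∉ A) (π : Perm T) :
    weight ν c A (l ++ x :: y :: l') π -
        weight ν c A (l ++ x :: y :: l') (swap x y * π * swap x y) =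
      loopWeight ν y (π * swap x y) • weight ν c A (l ++ x :: l') (isolate y (π * swap x y)) -
        loopWeight ν x (π * swap x y) •
          weight ν c A (l ++ y :: l') (isolate x (π * swap x y)) := by
  have hxA : x ∉ A := hA x (by simp)
  have hyA : y ∉ A := hA y (by simp)
  have hn' := hn
  simp only [List.nodup_append, List.nodup_cons, List.mem_cons] at hn'
  obtain ⟨hn1, ⟨hx, hy, hn2⟩, hn3⟩ := hn'
  push Not at hx
  have hxy : x ≠ y := hx.1
  have hxl : x ∉ l := fun h => hn3 x h x (Or.inl rfl) rfl
  have hyl : y ∉ l := fun h => hn3 y h y (Or.inr (Or.inl rfl)) rfl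
  have hσ : ∀ t, swap x y t ∈ A ↔ t ∈ A := by
    intro t
    rw [swap_apply_def]
    split_ifs with h1 h2
    · subst h1; simp [hxA, hyA]
    · subst h2; simp [hxA, hyA]
    · rfl
  have hfix : ∀ m : List T, x ∉ m → y ∉ m → m.map (swap x y) = m := by
    intro m h1 h2
    conv_rhs => rw [← List.map_id m]
    exact List.map_congr_left fun z hz =>
      swap_apply_of_ne_of_ne (fun h => h1 (h ▸ hz)) (fun h => h2 (h ▸ hz))
  have hs1 := ofPerm_mul_jmProd c l hσ
  rw [hfix l hxl hyl] at hs1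
  have hs2 := ofPerm_mul_jmProd c (l ++ x :: y :: l') hσ
  rw [List.map_append, List.map_cons, List.map_cons, hfix l hxl hyl, hfix l' hx.2 hy,
    swap_apply_left, swap_apply_right] at hs2
  have e1 : weight ν c A (l ++ x :: y :: l') (swap x y * π * swap x y) =
      ltrace ν (l ++ x :: y :: l') (ofPerm R π * jmProd c A (l ++ y :: x :: l')) := by
    rw [weight, mul_assoc, map_mul, mul_assoc,
      ltrace_swap_mul ν hn (by simp) (by simp), map_mul, mul_assoc, mul_assoc,
      ← mul_assoc (ofPerm R (swap x y)), hs2, mul_assoc, ← map_mul, swap_mul_self, map_one, mul_one]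
  have e2 : ofPerm R π * jmProd c A (l ++ x :: y :: l') -
      ofPerm R π * jmProd c A (l ++ y :: x :: l') =
      ofPerm R (π * swap x y) * jmProd c A (l ++ x :: l') -
        ofPerm R (π * swap x y) * jmProd c A (l ++ y :: l') := by
    have h := jm_commutator c hxy hxA hyA
    simp only [jmProd_append, jmProd_cons, map_mul]
    calc _ = ofPerm R π * jmProd c A l * (jm c A x * jm c A y - jm c A y * jm c A x) *
          jmProd c A l' := by noncomm_ring
      _ = ofPerm R π * (jmProd c A l * ofPerm R (swap x y)) * (jm c A x - jm c A y) *
          jmProd c A l' := by rw [h]; noncomm_ring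
      _ = _ := by rw [← hs1]; noncomm_ring
  rw [e1, weight, ← ltrace_sub, e2, ltrace_sub]
  congr 1
  · have hp : (l ++ x :: y :: l').Perm (y :: (l ++ x :: l')) := by
      simpa using (List.perm_middle (a := y) (l₁ := l ++ [x]) (l₂ := l'))
    rw [ltrace_perm ν hp, ltrace_cons', ptrace_mul_right ν (S := {t | t ∈ l ++ x :: l'} ∪ ↑A),
      ptrace_ofPerm, smul_mul_assoc, ltrace_smul, weight]
    · exact jmProd_mem_supp c A (fun x hx => Or.inl hx) Set.subset_union_right
    · rintro (h | h)
      · simp only [List.mem_append, List.mem_cons, Set.mem_ofPred_eq] at h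
        rcases h with h | h | h
        · exact hyl h
        · exact hxy h.symm
        · exact hy h
      · exact hyA h
  · have hp : (l ++ x :: y :: l').Perm (x :: (l ++ y :: l')) := List.perm_middle
    rw [ltrace_perm ν hp, ltrace_cons', ptrace_mul_right ν (S := {t | t ∈ l ++ y :: l'} ∪ ↑A),
      ptrace_ofPerm, smul_mul_assoc, ltrace_smul, weight]
    · exact jmProd_mem_supp c A (fun x hx => Or.inl hx) Set.subset_union_right
    · rintro (h | h)
      · simp only [List.mem_append, List.mem_cons, Set.mem_ofPred_eq] at h
        rcases h with h | h | h
        · exact hxl h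
        · exact hxy h
        · exact hx.2 h
      · exact hxA h

end Weight

end UniversalGl

/-! ### Traces of increasing and decreasing cycles. -/

namespace UniversalGl

open Equiv

theorem notMem_tail_supp {T : Type*} {A : Finset T} {x y : T} {l : List T} (hn : (x :: y :: l).Nodup)
    (hA : ∀ z ∈ x :: y :: l, z ∉ A) : y ∉ {t | t ∈ x :: l} ∪ (A : Set T) := by
  simp only [List.nodup_cons, List.mem_cons, not_or] at hn
  rintro (h | h)
  · rcases List.mem_cons.1 h with h | h
    · exact hn.1.1 h.symm
    · exact hn.2.1 h
  · exact hA y (by simp) h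

section Cycles

variable {R T : Type*} [CommRing R] [DecidableEq T]

theorem formPerm_map_perm (σ : Perm T) (l : List T) :
    (l.map σ).formPerm = σ * l.formPerm * σ⁻¹ := by
  induction l with
  | nil => simp
  | cons x l ih =>
    cases l with
    | nil => simp
    | cons y l =>
      rw [List.map_cons] at ih
      rw [List.map_cons, List.map_cons, List.formPerm_cons_cons, List.formPerm_cons_cons, ih,
        swap_apply_apply]
      group

theorem swap_mul_formPerm_mul_swap {x y : T} {l : List T} (hx : x ∉ l) (hy : y ∉ l) :
    swap x y * (y :: l).formPerm * swap x y = (x :: l).formPerm := by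
  have h := formPerm_map_perm (swap x y) (y :: l)
  rw [List.map_cons, swap_apply_right, swap_inv] at h
  rw [← h]
  congr 2
  conv_rhs => rw [← List.map_id l]
  exact List.map_congr_left fun z hz =>
    swap_apply_of_ne_of_ne (fun h => hx (h ▸ hz)) (fun h => hy (h ▸ hz))

theorem formPerm_mem_supp {l : List T} {S : Set T} (h : ∀ x ∈ l, x ∈ S) :
    ofPerm R l.formPerm ∈ supp R S :=
  ofPerm_mem_supp fun t ht => List.formPerm_apply_of_notMem fun h' => ht (h t h')

theorem formPerm_inv_mem_supp {l : List T} {S : Set T} (h : ∀ x ∈ l, x ∈ S) :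
    ofPerm R l.formPerm⁻¹ ∈ supp R S :=
  ofPerm_mem_supp fun t ht => by
    rw [Perm.inv_eq_iff_eq, List.formPerm_apply_of_notMem fun h' => ht (h t h')]

/-- The partial trace of a power of a Jucys–Murphy type element. -/
noncomputable def powerTrace (ν c : R) (A : Finset T) (x : T) (k : ℕ) : PermAlg R T :=
  ptrace ν x (jm c A x ^ k)

theorem powerTrace_mem_supp (ν c : R) (A : Finset T) (x : T) (k : ℕ) :
    powerTrace ν c A x k ∈ supp R (A : Set T) := by
  refine supp_mono ?_ (ptrace_mem_supp ν (pow_mem (jm_mem_supp c A (S := insert x ↑A)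
    (Set.mem_insert _ _) (Set.subset_insert _ _)) k))
  rintro t ⟨h1 | h1, h2⟩
  · exact absurd h1 h2
  · exact h1

/-- The trace of the increasing cycle on `x :: l` with the point `x` carrying a `k`-th power. -/
noncomputable def cycleTrace (ν c : R) (A : Finset T) (x : T) (l : List T) (k : ℕ) :
    PermAlg R T :=
  ltrace ν (x :: l) (ofPerm R (x :: l).formPerm * (jm c A x ^ k * jmProd c A l))

/-- The trace of the decreasing cycle on `x :: l` with the point `x` carrying a `k`-th power. -/
noncomputable def invCycleTrace (ν c : R) (A : Finset T) (x : T) (l : List T) (k : ℕ) :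
    PermAlg R T :=
  ltrace ν (x :: l) (ofPerm R (x :: l).formPerm⁻¹ * (jm c A x ^ k * jmProd c A l))

theorem cycleTrace_nil (ν c : R) (A : Finset T) (x : T) (k : ℕ) :
    cycleTrace ν c A x [] k = powerTrace ν c A x k := by
  simp [cycleTrace, powerTrace, ltrace, jmProd]

theorem invCycleTrace_nil (ν c : R) (A : Finset T) (x : T) (k : ℕ) :
    invCycleTrace ν c A x [] k = powerTrace ν c A x k := by
  simp [invCycleTrace, powerTrace, ltrace, jmProd]

/-- Taking the partial trace over `y` of a product with a single factor `swap x y`. -/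
theorem ltrace_mul_swap_mul (ν : R) {x y : T} {l : List T} {S : Set T} {u v : PermAlg R T}
    (hxy : x ≠ y) (hu : u ∈ supp R S) (hv : v ∈ supp R S) (hy : y ∉ S) :
    ltrace ν (x :: y :: l) (u * (ofPerm R (swap x y) * v)) = ltrace ν (x :: l) (u * v) := by
  rw [ltrace_perm ν (List.Perm.swap y x l), ltrace_cons', ptrace_mul_left ν _ hu hy,
    ptrace_mul_right ν _ hv hy, swap_comm, ptrace_swap ν hxy.symm, one_mul]

theorem ltrace_cons_free (ν : R) {x y : T} {l : List T} {S : Set T} {u : PermAlg R T}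
    (hu : u ∈ supp R S) (hy : y ∉ S) :
    ltrace ν (x :: y :: l) u = ν • ltrace ν (x :: l) u := by
  rw [ltrace_perm ν (List.Perm.swap y x l), ltrace_cons', ptrace_of_mem_supp ν hu hy, ltrace_smul]

theorem jm_pow_mul_jmProd_mem_supp (c : R) (A : Finset T) (x : T) (l : List T) (k : ℕ) :
    jm c A x ^ k * jmProd c A l ∈ supp R ({t | t ∈ x :: l} ∪ (A : Set T)) :=
  mul_mem (pow_mem (jm_mem_supp c A (Or.inl List.mem_cons_self) Set.subset_union_right) _)
    (jmProd_mem_supp c A (fun _ hx => Or.inl (List.mem_cons_of_mem _ hx)) Set.subset_union_right)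

theorem ofPerm_swap_mul_jmProd (c : R) {A : Finset T} {x y : T} {l : List T} (hx : x ∉ l)
    (hy : y ∉ l) (hxA : x ∉ A) (hyA : y ∉ A) :
    ofPerm R (swap x y) * jmProd c A l = jmProd c A l * ofPerm R (swap x y) := by
  refine commute_of_disjoint (S := {x, y}) (S' := {t | t ∈ l} ∪ (A : Set T)) ?_
    (ofPerm_mem_supp fun t ht => ?_) (jmProd_mem_supp c A (fun _ h => Or.inl h)
      Set.subset_union_right)
  · refine Set.disjoint_left.2 ?_
    rintro t (rfl | rfl) (h | h)
    · exact hx h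
    · exact hxA h
    · exact hy h
    · exact hyA h
  · exact swap_apply_of_ne_of_ne (fun h => ht (Or.inl h)) (fun h => ht (Or.inr h))

section

variable (ν c : R) {A : Finset T} {x y : T} {l : List T} (hn : (x :: y :: l).Nodup)
  (hA : ∀ z ∈ x :: y :: l, z ∉ A) (k : ℕ)

include hn hA

/-- Along the decreasing cycle the factors are met in the order of the product, so they multiply as
matrices. Writing `J_y = (x y) J_x (x y)` leaves one transposition between `J_x ^ k` and `J_x`;
tracing over `y` removes it and the exponents add. -/
theorem invCycleTrace_cons :
    invCycleTrace ν c A x (y :: l) k = invCycleTrace ν c A x l (k + 1) := by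
  have hy := notMem_tail_supp hn hA
  have hn' := hn
  simp only [List.nodup_cons, List.mem_cons, not_or] at hn'
  obtain ⟨⟨hxy, hx⟩, hyl, -⟩ := hn'
  have hxA : x ∉ A := hA x (by simp)
  have hyA : y ∉ A := hA y (by simp)
  have e1 : (x :: y :: l).formPerm⁻¹ = swap x y * (x :: l).formPerm⁻¹ := by
    rw [← swap_mul_formPerm_mul_swap hx hyl, List.formPerm_cons_cons]
    simp [mul_assoc]
  have e2 : jm c A y = ofPerm R (swap x y) * jm c A x * ofPerm R (swap x y) := by
    rw [jm_mul_ofPerm_swap c hxA hyA, mul_assoc, ← map_mul, swap_mul_self, map_one, mul_one]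
  have e3 : jm c A x ^ k * jmProd c A (y :: l) =
      jm c A x ^ k * ofPerm R (swap x y) * jm c A x * jmProd c A l * ofPerm R (swap x y) := by
    rw [jmProd_cons, e2]
    simp only [mul_assoc]
    rw [ofPerm_swap_mul_jmProd c hx hyl hxA hyA]
  rw [invCycleTrace, e1, map_mul, mul_assoc, ltrace_swap_mul ν hn (by simp) (by simp), e3,
    invCycleTrace]
  have e4 : ofPerm R (x :: l).formPerm⁻¹ * (jm c A x ^ k * ofPerm R (swap x y) * jm c A x *
      jmProd c A l * ofPerm R (swap x y)) * ofPerm R (swap x y) =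
      (ofPerm R (x :: l).formPerm⁻¹ * jm c A x ^ k) * (ofPerm R (swap x y) *
        (jm c A x ^ 1 * jmProd c A l)) := by
    simp only [mul_assoc, pow_one]
    rw [← map_mul, swap_mul_self, map_one, mul_one]
  rw [e4, ltrace_mul_swap_mul ν hxy
    (mul_mem (formPerm_inv_mem_supp fun _ h => Or.inl h)
      (pow_mem (jm_mem_supp c A (Or.inl List.mem_cons_self) Set.subset_union_right) _))
    (jm_pow_mul_jmProd_mem_supp c A x l 1) hy, pow_one, pow_succ]
  simp only [mul_assoc]

/-- Here `J_x ^ k` and `J_y` stand in the opposite order and must first be commuted by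
`jm_pow_commutator`. The main term merges into `J_x ^ (k + 1)`. In the second term `y` carries no
factor and becomes a free loop, worth `ν`. In the third, cyclicity cuts `x` off the cycle, leaving a
loop that carries `J_x ^ k`. -/
theorem cycleTrace_cons :
    cycleTrace ν c A x (y :: l) k = cycleTrace ν c A x l (k + 1) + ν • cycleTrace ν c A x l k -
      powerTrace ν c A x k * cycleTrace ν c A y l 0 := by
  have hy := notMem_tail_supp hn hA
  have hn' := hn
  simp only [List.nodup_cons, List.mem_cons, not_or] at hn'
  obtain ⟨⟨hxy, hx⟩, hyl, -⟩ := hn'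
  have hxA : x ∉ A := hA x (by simp)
  have hyA : y ∉ A := hA y (by simp)
  have e1 : (x :: y :: l).formPerm = (x :: l).formPerm * swap x y := by
    rw [← swap_mul_formPerm_mul_swap hx hyl, List.formPerm_cons_cons]
    simp [mul_assoc]
  set s := ofPerm R (swap x y) with hs
  set γ := ofPerm R (x :: l).formPerm with hγ
  set J := jm c A x with hJ
  set Y := jmProd c A l with hY
  have hss : s * s = 1 := by rw [hs, ← map_mul, swap_mul_self, map_one]
  have hJs : s * jm c A y = J * s := by
    rw [hs, swap_comm, jm_mul_ofPerm_swap c hyA hxA]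
  have hsY : s * Y = Y * s := ofPerm_swap_mul_jmProd c hx hyl hxA hyA
  have e2 : ofPerm R (x :: y :: l).formPerm * (J ^ k * jmProd c A (y :: l)) =
      γ * J * (s * (J ^ k * Y)) + γ * (J ^ k * Y) - γ * s * (J ^ k * Y) * s := by
    rw [e1, map_mul, jmProd_cons, ← mul_assoc (J ^ k), jm_pow_commutator c hxy hxA hyA, ← hs, ← hγ,
      ← hJ, ← hY]
    calc γ * s * ((jm c A y * J ^ k + s * J ^ k - J ^ k * s) * Y)
        = γ * (s * jm c A y) * (J ^ k * Y) + γ * (s * s) * J ^ k * Y -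
          γ * s * J ^ k * (s * Y) := by noncomm_ring
      _ = _ := by rw [hJs, hss, hsY]; noncomm_ring
  have m1 : J ^ k * Y ∈ supp R ({t | t ∈ x :: l} ∪ (A : Set T)) :=
    jm_pow_mul_jmProd_mem_supp c A x l k
  have m2 : γ ∈ supp R ({t | t ∈ x :: l} ∪ (A : Set T)) := formPerm_mem_supp fun _ h => Or.inl h
  have m3 : J ∈ supp R ({t | t ∈ x :: l} ∪ (A : Set T)) :=
    jm_mem_supp c A (Or.inl List.mem_cons_self) Set.subset_union_right
  have t1 : ltrace ν (x :: y :: l) (γ * J * (s * (J ^ k * Y))) = cycleTrace ν c A x l (k + 1) := by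
    rw [ltrace_mul_swap_mul ν hxy (mul_mem m2 m3) m1 hy, cycleTrace, pow_succ']
    simp only [mul_assoc]
    rfl
  have t2 : ltrace ν (x :: y :: l) (γ * (J ^ k * Y)) = ν • cycleTrace ν c A x l k :=
    ltrace_cons_free ν (mul_mem m2 m1) hy
  have t3 : ltrace ν (x :: y :: l) (γ * s * (J ^ k * Y) * s) =
      powerTrace ν c A x k * cycleTrace ν c A y l 0 := by
    rw [← ltrace_swap_mul ν hn (by simp) (by simp), ← hs]
    have e3 : s * (γ * s * (J ^ k * Y)) = ofPerm R (y :: l).formPerm * (J ^ k * Y) := by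
      rw [hγ, hs, ← swap_mul_formPerm_mul_swap hx hyl, ← mul_assoc, ← map_mul, ← map_mul]
      simp only [mul_assoc, swap_mul_self, mul_one, swap_mul_self_mul]
    have hxS : x ∉ {t | t ∈ y :: l} ∪ (A : Set T) := by
      rintro (h | h)
      · rcases List.mem_cons.1 h with h | h
        · exact hxy h
        · exact hx h
      · exact hxA h
    have m4 : ofPerm R (y :: l).formPerm ∈ supp R ({t | t ∈ y :: l} ∪ (A : Set T)) :=
      formPerm_mem_supp fun _ h => Or.inl h
    have m5 : Y ∈ supp R ({t | t ∈ y :: l} ∪ (A : Set T)) :=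
      jmProd_mem_supp c A (fun _ h => Or.inl (List.mem_cons_of_mem _ h)) Set.subset_union_right
    have m6 : ofPerm R (y :: l).formPerm ∈ supp R {t | t ∈ y :: l} :=
      formPerm_mem_supp fun _ h => h
    have hd : Disjoint {t | t ∈ y :: l} (A : Set T) :=
      Set.disjoint_left.2 fun t h1 h2 => hA t (List.mem_cons_of_mem _ h1) h2
    rw [e3, ltrace_cons', ptrace_mul_left ν _ m4 hxS, ptrace_mul_right ν _ m5 hxS, ← mul_assoc,
      show ptrace ν x (J ^ k) = powerTrace ν c A x k from rfl,
      commute_of_disjoint hd m6 (powerTrace_mem_supp ν c A x k), mul_assoc,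
      ltrace_mul_left ν _ (powerTrace_mem_supp ν c A x k)
        (fun z hz => hA z (List.mem_cons_of_mem _ hz)), cycleTrace, pow_zero, one_mul]
  rw [cycleTrace, e2, ltrace_sub, ltrace_add, t1, t2, t3]

/-- A point that carries no factor can be removed from an increasing cycle. -/
theorem cycleTrace_cons_zero :
    cycleTrace ν c A x (y :: l) 0 = weight ν c A (y :: l) (y :: l).formPerm := by
  have hn' := hn
  simp only [List.nodup_cons, List.mem_cons, not_or] at hn'
  have hxS : x ∉ {t | t ∈ y :: l} ∪ (A : Set T) := by
    rintro (h | h)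
    · rcases List.mem_cons.1 h with h | h
      · exact hn'.1.1 h
      · exact hn'.1.2 h
    · exact hA x (by simp) h
  rw [cycleTrace, pow_zero, one_mul, ltrace_cons', List.formPerm_cons_cons, map_mul (ofPerm R),
    mul_assoc, ptrace_mul_right ν _ (S := {t | t ∈ y :: l} ∪ (A : Set T)) _ hxS, ptrace_swap ν hn'.1.1,
    one_mul, weight]
  exact mul_mem (formPerm_mem_supp fun _ h => Or.inl h)
    (jmProd_mem_supp c A (fun _ h => Or.inl h) Set.subset_union_right)

/-- A point that carries no factor can be removed from a decreasing cycle. -/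
theorem invCycleTrace_cons_zero :
    invCycleTrace ν c A x (y :: l) 0 = weight ν c A (y :: l) (y :: l).formPerm⁻¹ := by
  have hn' := hn
  simp only [List.nodup_cons, List.mem_cons, not_or] at hn'
  have hxS : x ∉ {t | t ∈ y :: l} ∪ (A : Set T) := by
    rintro (h | h)
    · rcases List.mem_cons.1 h with h | h
      · exact hn'.1.1 h
      · exact hn'.1.2 h
    · exact hA x (by simp) h
  have m1 : ofPerm R (y :: l).formPerm⁻¹ ∈ supp R ({t | t ∈ y :: l} ∪ (A : Set T)) :=
    formPerm_inv_mem_supp fun _ h => Or.inl h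
  have m2 : jmProd c A (y :: l) ∈ supp R ({t | t ∈ y :: l} ∪ (A : Set T)) :=
    jmProd_mem_supp c A (fun _ h => Or.inl h) Set.subset_union_right
  rw [invCycleTrace, pow_zero, one_mul, ltrace_cons', List.formPerm_cons_cons, mul_inv_rev,
    swap_inv, map_mul (ofPerm R), mul_assoc, ptrace_mul_left ν _ m1 hxS, ptrace_mul_right ν _ m2 hxS,
    ptrace_swap ν hn'.1.1, one_mul, weight]

end

/-- Conjugation by `(x y)` turns one side into the other, and it is trivial on elements supported in
`A`. -/
theorem powerTrace_eq (ν c : R) {A : Finset T} {x y : T} (hx : x ∉ A) (hy : y ∉ A) (k : ℕ) :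
    powerTrace ν c A x k = powerTrace ν c A y k := by
  have hpow : ofPerm R (swap x y) * jm c A x ^ k = jm c A y ^ k * ofPerm R (swap x y) := by
    induction k with
    | zero => simp
    | succ k ih =>
      rw [pow_succ', ← mul_assoc, jm_mul_ofPerm_swap c hx hy, mul_assoc, ih, ← mul_assoc, pow_succ']
  have h := ptrace_conj ν (swap x y) x (jm c A x ^ k)
  rw [swap_apply_left, hpow, swap_inv, mul_assoc, ← map_mul, swap_mul_self, map_one, mul_one] at h
  rw [powerTrace, powerTrace, h]
  have hd : Disjoint {x, y} (A : Set T) := Set.disjoint_left.2 fun t h1 h2 => by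
    rcases h1 with rfl | rfl
    · exact hx h2
    · exact hy h2
  have hs : ofPerm R (swap x y) ∈ supp R {x, y} := ofPerm_mem_supp fun t ht =>
    swap_apply_of_ne_of_ne (fun h => ht (Or.inl h)) (fun h => ht (Or.inr h))
  have := commute_of_disjoint hd hs (powerTrace_mem_supp ν c A x k)
  rw [powerTrace] at this
  rw [this, mul_assoc, ← map_mul, swap_mul_self, map_one, mul_one]

theorem invCycleTrace_eq_powerTrace (ν c : R) {A : Finset T} {x : T} {l : List T}
    (hn : (x :: l).Nodup) (hA : ∀ z ∈ x :: l, z ∉ A) (k : ℕ) :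
    invCycleTrace ν c A x l k = powerTrace ν c A x (k + l.length) := by
  induction l generalizing k with
  | nil => exact invCycleTrace_nil ν c A x k
  | cons y l ih =>
    rw [invCycleTrace_cons ν c hn hA, ih, List.length_cons]
    · congr 1; ring
    · simp only [List.nodup_cons, List.mem_cons, not_or] at hn ⊢
      exact ⟨hn.1.2, hn.2.2⟩
    · exact fun z hz => hA z (by simp only [List.mem_cons] at hz ⊢; tauto)

/-- The increasing cycles expressed through power traces: `cyclePoly ν D a k` is the value of
`cycleTrace` for a list of length `a`. -/
def cyclePoly {B : Type*} [CommRing B] (ν : B) (D : ℕ → B) : ℕ → ℕ → B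
  | 0, k => D k
  | a + 1, k => cyclePoly ν D a (k + 1) + ν * cyclePoly ν D a k - D k * cyclePoly ν D a 0

/-- The recursion of `cycleTrace_cons` holds in a noncommutative algebra; lifting the power traces
along `φ` moves it to a commutative ring, where generating functions apply. -/
theorem cycleTrace_eq_of_hom {B : Type*} [CommRing B] (ν c : R) {A : Finset T}
    (φ : B →+* PermAlg R T) {ν' : B} (hν : φ ν' = algebraMap R _ ν) {D : ℕ → B}
    (hD : ∀ k, ∀ x ∉ A, φ (D k) = powerTrace ν c A x k)
    {x : T} {l : List T} (hn : (x :: l).Nodup) (hA : ∀ z ∈ x :: l, z ∉ A) (k : ℕ) :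
    cycleTrace ν c A x l k = φ (cyclePoly ν' D l.length k) := by
  induction l generalizing k x with
  | nil => rw [cycleTrace_nil, List.length_nil, cyclePoly, hD k x (hA x (by simp))]
  | cons y l ih =>
    have hn' := hn
    simp only [List.nodup_cons, List.mem_cons, not_or] at hn'
    have h1 : (x :: l).Nodup := List.nodup_cons.2 ⟨hn'.1.2, hn'.2.2⟩
    have h2 : ∀ z ∈ x :: l, z ∉ A :=
      fun z hz => hA z (by simp only [List.mem_cons] at hz ⊢; tauto)
    rw [cycleTrace_cons ν c hn hA, ih h1 h2, ih h1 h2,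
      ih (List.nodup_cons.1 hn).2 fun z hz => hA z (List.mem_cons_of_mem _ hz), List.length_cons,
      cyclePoly, map_sub, map_add, map_mul, map_mul, hν, hD k x (hA x (by simp)), Algebra.smul_def]

end Cycles

end UniversalGl

/-! ### Transport of permutations of `Fin n` to lists of labels. -/

namespace UniversalGl

open Equiv

/-- Brings the list of labels, and the two lists with one of the neighbours deleted, into the shape
used by `weight_recurrence`. -/
theorem exists_ofFn_eq_append {X : Type*} {n : ℕ} (e : Fin (n + 1) → X) (k : Fin n) :
    ∃ l l' : List X, List.ofFn e = l ++ e k.castSucc :: e k.succ :: l' ∧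
      List.ofFn (e ∘ k.succ.succAbove) = l ++ e k.castSucc :: l' ∧
      List.ofFn (e ∘ k.castSucc.succAbove) = l ++ e k.succ :: l' := by
  induction n with
  | zero => exact k.elim0
  | succ n ih =>
    cases k using Fin.cases with
    | zero =>
      refine ⟨[], List.ofFn fun i : Fin n => e i.succ.succ, ?_, ?_, ?_⟩
      · simp [List.ofFn_succ]
      · rw [List.ofFn_succ]
        simp
      · rw [List.ofFn_succ]
        simp
    | succ j =>
      obtain ⟨l, l', h1, h2, h3⟩ := ih (e ∘ Fin.succ) j
      refine ⟨e 0 :: l, l', ?_, ?_, ?_⟩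
      · rw [List.ofFn_succ, List.cons_append]
        exact congrArg _ h1
      · rw [List.ofFn_succ, List.cons_append]
        refine congrArg₂ _ (by simp) ?_
        rw [← Fin.succ_castSucc]
        refine Eq.trans ?_ h2
        congr 1
        ext i
        simp
      · rw [List.ofFn_succ, List.cons_append]
        refine congrArg₂ _ (by simp) ?_
        refine Eq.trans ?_ h3
        congr 1
        ext i
        simp

section Extend

variable {T : Type*} [DecidableEq T]

theorem viaFintypeEmbedding_apply_of_notMem {n : ℕ} (e : Fin n ↪ T) (α : Perm (Fin n)) {t : T}
    (ht : t ∉ List.ofFn e) : α.viaFintypeEmbedding e t = t :=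
  Perm.viaFintypeEmbedding_apply_notMem_range _ _ fun ⟨i, hi⟩ => ht (List.mem_ofFn.2 ⟨i, hi⟩)

theorem eq_viaFintypeEmbedding {n : ℕ} (e : Fin n ↪ T) (α : Perm (Fin n)) (π : Perm T)
    (h1 : ∀ i, π (e i) = e (α i)) (h2 : ∀ t ∉ List.ofFn e, π t = t) :
    π = α.viaFintypeEmbedding e := by
  ext t
  by_cases ht : t ∈ List.ofFn e
  · obtain ⟨i, rfl⟩ := List.mem_ofFn.1 ht
    rw [h1, Perm.viaFintypeEmbedding_apply_image]
  · rw [h2 t ht, viaFintypeEmbedding_apply_of_notMem e α ht]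

theorem viaFintypeEmbedding_mul {n : ℕ} (e : Fin n ↪ T) (α β : Perm (Fin n)) :
    (α * β).viaFintypeEmbedding e = α.viaFintypeEmbedding e * β.viaFintypeEmbedding e := by
  refine (eq_viaFintypeEmbedding e _ _ (fun i => ?_) fun t ht => ?_).symm
  · simp
  · simp [viaFintypeEmbedding_apply_of_notMem e _ ht]

theorem viaFintypeEmbedding_inv {n : ℕ} (e : Fin n ↪ T) (α : Perm (Fin n)) :
    (α⁻¹).viaFintypeEmbedding e = (α.viaFintypeEmbedding e)⁻¹ := by
  rw [eq_inv_iff_mul_eq_one, ← viaFintypeEmbedding_mul, inv_mul_cancel]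
  exact (eq_viaFintypeEmbedding e _ _ (fun i => rfl) fun t ht => rfl).symm

theorem viaFintypeEmbedding_swap {n : ℕ} (e : Fin n ↪ T) (i j : Fin n) :
    (swap i j).viaFintypeEmbedding e = swap (e i) (e j) := by
  refine (eq_viaFintypeEmbedding e _ _ (fun k => ?_) fun t ht => ?_).symm
  · exact e.injective.swap_apply _ _ _
  · exact swap_apply_of_ne_of_ne (fun h => ht (List.mem_ofFn.2 ⟨i, h.symm⟩))
      fun h => ht (List.mem_ofFn.2 ⟨j, h.symm⟩)

theorem viaFintypeEmbedding_trans {n : ℕ} (e : Fin n ↪ T) (σ : Perm T) (α : Perm (Fin n)) :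
    α.viaFintypeEmbedding (e.trans σ.toEmbedding) = σ * α.viaFintypeEmbedding e * σ⁻¹ := by
  refine (eq_viaFintypeEmbedding _ _ _ (fun i => ?_) fun t ht => ?_).symm
  · simp
  · have : σ⁻¹ t ∉ List.ofFn e := by
      intro h
      obtain ⟨i, hi⟩ := List.mem_ofFn.1 h
      exact ht (List.mem_ofFn.2 ⟨i, by simp [hi]⟩)
    rw [Perm.mul_apply, Perm.mul_apply, viaFintypeEmbedding_apply_of_notMem e _ this]
    simp

theorem viaFintypeEmbedding_finRotate {n : ℕ} (e : Fin n ↪ T) :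
    (finRotate n).viaFintypeEmbedding e = (List.ofFn e).formPerm := by
  refine (eq_viaFintypeEmbedding _ _ _ (fun i => ?_) fun t ht =>
    List.formPerm_apply_of_notMem ht).symm
  have hn : (List.ofFn e).Nodup := List.nodup_ofFn.2 e.injective
  have h := List.formPerm_apply_getElem (List.ofFn e) hn i (by simp)
  simp only [List.getElem_ofFn, Fin.eta] at h
  rw [h]
  congr 1
  ext
  cases n with
  | zero => exact i.elim0
  | succ n => simp [Fin.val_add]

theorem deletePoint_apply {n : ℕ} (j : Fin (n + 1)) (β : Perm (Fin (n + 1))) (i : Fin n) :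
    j.succAbove (deletePoint j β i) =
      if β (j.succAbove i) = j then β j else β (j.succAbove i) := by
  have key : ∀ a : Fin n, ∀ b : Fin (n + 1), some a = finSuccEquiv' j b → j.succAbove a = b := by
    intro a b h
    exact (finSuccEquiv'_eq_some.1 h.symm).symm
  have hs : ((finSuccEquiv' j).permCongr β) (some i) = finSuccEquiv' j (β (j.succAbove i)) := by
    simp [permCongr_apply]
  have hs0 : ((finSuccEquiv' j).permCongr β) none = finSuccEquiv' j (β j) := by
    simp [permCongr_apply]
  split_ifs with h
  · refine key _ _ ?_
    rw [← hs0]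
    refine removeNone_none _ ?_
    rw [hs, h, finSuccEquiv'_at]
  · refine key _ _ ?_
    rw [← hs]
    refine removeNone_some _ ?_
    rw [hs]
    refine Option.ne_none_iff_exists'.1 fun h' => h ?_
    exact (finSuccEquiv'_eq_none.1 h').symm

/-- The embedding of the remaining points after deleting `j`. -/
def deleteEmb {n : ℕ} (e : Fin (n + 1) ↪ T) (j : Fin (n + 1)) : Fin n ↪ T :=
  (Fin.succAboveEmb j).trans e

/-- `deletePoint` renumbers, whereas `isolate` keeps the point as a fixed one; the embedding that
skips `j` reconciles them. -/
theorem isolate_viaFintypeEmbedding {n : ℕ} (e : Fin (n + 1) ↪ T) (j : Fin (n + 1))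
    (β : Perm (Fin (n + 1))) :
    isolate (e j) (β.viaFintypeEmbedding e) =
      (deletePoint j β).viaFintypeEmbedding (deleteEmb e j) := by
  refine eq_viaFintypeEmbedding _ _ _ (fun i => ?_) fun t ht => ?_
  · have h1 : deleteEmb e j i = e (j.succAbove i) := rfl
    have h2 : deleteEmb e j (deletePoint j β i) = e (j.succAbove (deletePoint j β i)) := rfl
    rw [h2, deletePoint_apply, isolate_apply, h1, Perm.viaFintypeEmbedding_apply_image,
      Perm.viaFintypeEmbedding_apply_image, if_neg (fun h => Fin.succAbove_ne j i (e.injective h))]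
    by_cases h : β (j.succAbove i) = j <;> simp [h]
  · rw [isolate_apply]
    split_ifs with h1 h2
    · exact h1.symm
    · by_cases hr : t ∈ List.ofFn e
      · obtain ⟨i, rfl⟩ := List.mem_ofFn.1 hr
        obtain ⟨i, rfl⟩ := Fin.exists_succAbove_eq (fun h => h1 (congrArg e h))
        exact absurd (List.mem_ofFn.2 ⟨i, rfl⟩) ht
      · rw [viaFintypeEmbedding_apply_of_notMem e _ hr] at h2
        exact absurd h2 h1
    · by_cases hr : t ∈ List.ofFn e
      · obtain ⟨i, rfl⟩ := List.mem_ofFn.1 hr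
        obtain ⟨i, rfl⟩ := Fin.exists_succAbove_eq (fun h => h1 (congrArg e h))
        exact absurd (List.mem_ofFn.2 ⟨i, rfl⟩) ht
      · exact viaFintypeEmbedding_apply_of_notMem e _ hr

theorem viaFintypeEmbedding_concat {m n : ℕ} (e : Fin (m + n) ↪ T) (α : Perm (Fin m))
    (β : Perm (Fin n)) :
    (concat α β).viaFintypeEmbedding e =
      α.viaFintypeEmbedding ((Fin.castAddEmb n).trans e) *
        β.viaFintypeEmbedding ((Fin.natAddEmb m).trans e) := by
  have hc1 : ∀ i, concat α β (Fin.castAdd n i) = Fin.castAdd n (α i) := by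
    intro i; simp [concat, permCongr_apply]
  have hc2 : ∀ i, concat α β (Fin.natAdd m i) = Fin.natAdd m (β i) := by
    intro i; simp [concat, permCongr_apply]
  have h1 : ∀ i : Fin n, e (Fin.natAdd m i) ∉ List.ofFn ((Fin.castAddEmb n).trans e) := by
    intro i h
    obtain ⟨k, hk⟩ := List.mem_ofFn.1 h
    have := congrArg Fin.val (e.injective hk)
    simp at this
    omega
  have h2 : ∀ i : Fin m, e (Fin.castAdd n i) ∉ List.ofFn ((Fin.natAddEmb m).trans e) := by
    intro i h
    obtain ⟨k, hk⟩ := List.mem_ofFn.1 h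
    have := congrArg Fin.val (e.injective hk)
    simp at this
    omega
  refine (eq_viaFintypeEmbedding _ _ _ (fun i => ?_) fun t ht => ?_).symm
  · rw [Perm.mul_apply]
    cases i using Fin.addCases with
    | left i =>
      rw [viaFintypeEmbedding_apply_of_notMem _ β (h2 i), hc1]
      exact Perm.viaFintypeEmbedding_apply_image α ((Fin.castAddEmb n).trans e) i
    | right i =>
      have := Perm.viaFintypeEmbedding_apply_image β ((Fin.natAddEmb m).trans e) i
      simp only [Function.Embedding.trans_apply, Fin.natAddEmb_apply] at this
      rw [this, viaFintypeEmbedding_apply_of_notMem _ α (h1 _), hc2]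
  · rw [Perm.mul_apply, viaFintypeEmbedding_apply_of_notMem _ β,
      viaFintypeEmbedding_apply_of_notMem _ α]
    · intro h
      obtain ⟨i, rfl⟩ := List.mem_ofFn.1 h
      exact ht (List.mem_ofFn.2 ⟨_, rfl⟩)
    · intro h
      obtain ⟨i, rfl⟩ := List.mem_ofFn.1 h
      exact ht (List.mem_ofFn.2 ⟨_, rfl⟩)

end Extend

end UniversalGl

/-! ### Weight systems in arbitrary rings and universal polynomials. -/

namespace UniversalGl

open Equiv

theorem cycleType_viaFintypeEmbedding {m n : ℕ} (e : Fin m ↪ Fin n) (α : Perm (Fin m)) :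
    (α.viaFintypeEmbedding e).cycleType = α.cycleType := by
  rw [Perm.viaFintypeEmbedding]
  exact Perm.cycleType_extendDomain _

theorem cycleType_concat {m n : ℕ} (α : Perm (Fin m)) (β : Perm (Fin n)) :
    (concat α β).cycleType = α.cycleType + β.cycleType := by
  have h := viaFintypeEmbedding_concat (Function.Embedding.refl _) α β
  have h0 : (concat α β).viaFintypeEmbedding (Function.Embedding.refl _) = concat α β :=
    (eq_viaFintypeEmbedding _ _ _ (fun i => rfl) fun t ht =>
      absurd (List.mem_ofFn.2 ⟨t, rfl⟩) ht).symm
  rw [h0] at h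
  rw [h, Perm.Disjoint.cycleType_mul, cycleType_viaFintypeEmbedding, cycleType_viaFintypeEmbedding]
  intro t
  cases t using Fin.addCases with
  | left i =>
    refine Or.inr (viaFintypeEmbedding_apply_of_notMem _ _ fun h => ?_)
    obtain ⟨k, hk⟩ := List.mem_ofFn.1 h
    have := congrArg Fin.val hk
    simp at this
    omega
  | right i =>
    refine Or.inl (viaFintypeEmbedding_apply_of_notMem _ _ fun h => ?_)
    obtain ⟨k, hk⟩ := List.mem_ofFn.1 h
    have := congrArg Fin.val hk
    simp at this
    omega

/-- Up to conjugation every permutation splits off a standard cycle. -/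
theorem exists_isConj_concat {n : ℕ} (α : Perm (Fin (n + 1))) :
    ∃ m k, ∃ h : m + (k + 1) = n + 1, ∃ α' : Perm (Fin m),
      IsConj ((finCongr h).permCongr (concat α' (finRotate (k + 1)))) α := by
  by_cases hα : α.cycleType = 0
  · rw [Perm.cycleType_eq_zero] at hα
    subst hα
    -- `cycleType` omits fixed points, so the identity is treated apart: a fixed point is split off
    -- as a cycle of length 1.
    refine ⟨n, 0, rfl, 1, ?_⟩
    rw [Perm.isConj_iff_cycleType_eq]
    have : (finCongr (rfl : n + (0 + 1) = n + 1)).permCongr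
      (concat (1 : Perm (Fin n)) (finRotate (0 + 1))) = concat 1 (finRotate 1) := rfl
    rw [this, cycleType_concat]
    simp
    rfl
  · obtain ⟨k, hk⟩ := Multiset.exists_mem_of_ne_zero hα
    have h2 : 2 ≤ k := Perm.two_le_of_mem_cycleType hk
    have hs := Perm.sum_cycleType_le α
    have he := Multiset.cons_erase hk
    have hs' : k + (α.cycleType.erase k).sum ≤ n + 1 := by
      rw [← Multiset.sum_cons, he]
      simpa using hs
    obtain ⟨m, hm⟩ : ∃ m, m + k = n + 1 := ⟨n + 1 - k, by omega⟩
    obtain ⟨j, rfl⟩ : ∃ j, k = j + 1 := ⟨k - 1, by omega⟩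
    obtain ⟨α', hα'⟩ := (Perm.exists_with_cycleType_iff (α := Fin m)
      (m := α.cycleType.erase (j + 1))).2
        ⟨by rw [Fintype.card_fin]; omega,
          fun a ha => Perm.two_le_of_mem_cycleType (Multiset.mem_of_mem_erase ha)⟩
    refine ⟨m, j, hm, α', ?_⟩
    obtain rfl : n = m + j := by omega
    rw [Perm.isConj_iff_cycleType_eq]
    have : (finCongr hm).permCongr (concat α' (finRotate (j + 1))) =
      concat α' (finRotate (j + 1)) := rfl
    rw [this, cycleType_concat, hα', cycleType_finRotate_of_le h2, add_comm, Multiset.singleton_add]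
    exact he

/-- The defining relations of a weight system with values in an arbitrary ring, with no condition
on the values at the standard cycles. -/
structure IsWeightSystem {B : Type*} [CommRing B] (ν : B) (W : (m : ℕ) → Perm (Fin m) → B) :
    Prop where
  unit : W 0 1 = 1
  multiplicative : ∀ (m n : ℕ) (α : Perm (Fin m)) (β : Perm (Fin n)),
    W (m + n) (concat α β) = W m α * W n β
  recurrence : ∀ (n : ℕ) (α : Perm (Fin (n + 1))) (k : Fin n),
    let s : Perm (Fin (n + 1)) := swap k.castSucc k.succ
    W (n + 1) α - W (n + 1) (s * α * s) =
      loopWeight ν k.succ (α * s) * W n (deletePoint k.succ (α * s)) -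
        loopWeight ν k.castSucc (α * s) * W n (deletePoint k.castSucc (α * s))

/-- A property of permutations which is invariant under conjugation by adjacent transpositions is
invariant under conjugation. -/
theorem of_isConj {n : ℕ} {Q : Perm (Fin (n + 1)) → Prop}
    (h : ∀ (k : Fin n) (α : Perm (Fin (n + 1))), Q α →
      Q (swap k.castSucc k.succ * α * swap k.castSucc k.succ))
    {α β : Perm (Fin (n + 1))} (hc : IsConj α β) (hα : Q α) : Q β := by
  obtain ⟨σ, rfl⟩ := isConj_iff.1 hc
  have hσ : σ ∈ Submonoid.closure (Set.range fun i : Fin n => swap i.castSucc i.succ) := by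
    rw [Perm.mclosure_swap_castSucc_succ]; trivial
  clear hc
  induction hσ using Submonoid.closure_induction generalizing α with
  | mem σ hσ =>
    obtain ⟨k, rfl⟩ := hσ
    simpa using h k α hα
  | one => simpa using hα
  | mul σ τ _ _ ih1 ih2 => simpa [mul_assoc] using ih1 (ih2 hα)

/-- The values of a weight system are universal polynomials in its values at standard cycles. -/
theorem exists_poly (m : ℕ) (α : Perm (Fin m)) : ∃ p : PolyRing,
    ∀ (B : Type) [CommRing B] [Algebra (Polynomial ℂ) B] (W : (m : ℕ) → Perm (Fin m) → B),
      IsWeightSystem (algebraMap (Polynomial ℂ) B Polynomial.X) W →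
        W m α = MvPolynomial.aeval (fun k : ℕ+ => W k (finRotate k)) p := by
  induction m using Nat.strong_induction_on with
  | _ m ih =>
    cases m with
    | zero =>
      refine ⟨1, fun B _ _ W hW => ?_⟩
      rw [map_one, ← hW.unit]
      congr 1
      exact Subsingleton.elim _ _
    | succ n =>
      obtain ⟨m, k, h, α', hc⟩ := exists_isConj_concat α
      -- By the recurrence, conjugation by an adjacent transposition changes the value only by terms
      -- with one point fewer, covered by `ih`. One representative of each conjugacy class is
      -- therefore enough.
      refine of_isConj (Q := fun α => ∃ p : PolyRing,
        ∀ (B : Type) [CommRing B] [Algebra (Polynomial ℂ) B] (W : (m : ℕ) → Perm (Fin m) → B),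
          IsWeightSystem (algebraMap (Polynomial ℂ) B Polynomial.X) W →
            W (n + 1) α = MvPolynomial.aeval (fun k : ℕ+ => W k (finRotate k)) p) ?_ hc ?_
      · rintro k β ⟨p, hp⟩
        obtain ⟨p1, hp1⟩ := ih n (Nat.lt_succ_self n)
          (deletePoint k.succ (β * swap k.castSucc k.succ))
        obtain ⟨p2, hp2⟩ := ih n (Nat.lt_succ_self n)
          (deletePoint k.castSucc (β * swap k.castSucc k.succ))
        refine ⟨p - (loopFactor k.succ (β * swap k.castSucc k.succ) * p1 -
          loopFactor k.castSucc (β * swap k.castSucc k.succ) * p2), fun B _ _ W hW => ?_⟩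
        have hr := hW.recurrence n β k
        have hl : ∀ (j : Fin (n + 1)) (γ : Perm (Fin (n + 1))),
            MvPolynomial.aeval (fun k : ℕ+ => W k (finRotate k)) (loopFactor j γ) =
              loopWeight (algebraMap (Polynomial ℂ) B Polynomial.X) j γ := by
          intro j γ
          rw [loopFactor, loopWeight]
          split_ifs
          · simp [N]
          · simp
        rw [map_sub, map_sub, map_mul, map_mul, hl, hl, ← hp B W hW, ← hp1 B W hW, ← hp2 B W hW,
          ← hr, sub_sub_cancel]
      · obtain ⟨p, hp⟩ := ih m (by omega) α'
        refine ⟨p * MvPolynomial.X k.succPNat, fun B _ _ W hW => ?_⟩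
        obtain rfl : n = m + k := by omega
        have := hW.multiplicative m (k + 1) α' (finRotate (k + 1))
        rw [map_mul, ← hp B W hW, MvPolynomial.aeval_X]
        exact this

/-- The value at the empty permutation is forced: concatenating it with the 1-cycle gives `C₁ = C₁ *
w 0 1`, and `C₁` can be cancelled. -/
theorem IsGlWeightSystem.isWeightSystem {w : (m : ℕ) → Perm (Fin m) → PolyRing}
    (hw : IsGlWeightSystem w) :
    IsWeightSystem (algebraMap (Polynomial ℂ) PolyRing Polynomial.X) w where
  unit := by
    have h1 := hw.multiplicative 1 0 (finRotate 1) 1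
    have h2 : w (1 + 0) (concat (finRotate 1) 1) = w 1 (finRotate 1) :=
      congrArg (w 1) (Subsingleton.elim (α := Perm (Fin 1)) _ _)
    have h3 := hw.cyclic 1
    rw [PNat.one_coe] at h3
    rw [h2, h3] at h1
    exact (mul_left_cancel₀ (MvPolynomial.X_ne_zero (1 : ℕ+)) (by rw [mul_one, ← h1]))
  multiplicative := hw.multiplicative
  recurrence := hw.recurrence

theorem IsGlWeightSystem.ext {w w' : (m : ℕ) → Perm (Fin m) → PolyRing}
    (hw : IsGlWeightSystem w) (hw' : IsGlWeightSystem w') : w = w' := by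
  funext m α
  obtain ⟨p, hp⟩ := exists_poly m α
  rw [hp _ w hw.isWeightSystem, hp _ w' hw'.isWeightSystem]
  simp only [hw.cyclic, hw'.cyclic]

/-- Every weight system factors through the universal one. -/
theorem IsGlWeightSystem.eq_aeval {w : (m : ℕ) → Perm (Fin m) → PolyRing}
    (hw : IsGlWeightSystem w) {B : Type} [CommRing B] [Algebra (Polynomial ℂ) B]
    {W : (m : ℕ) → Perm (Fin m) → B}
    (hW : IsWeightSystem (algebraMap (Polynomial ℂ) B Polynomial.X) W) (m : ℕ)
    (α : Perm (Fin m)) :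
    W m α = MvPolynomial.aeval (fun k : ℕ+ => W k (finRotate k)) (w m α) := by
  obtain ⟨p, hp⟩ := exists_poly m α
  have : w m α = p := by
    rw [hp _ w hw.isWeightSystem]
    simp only [hw.cyclic]
    exact MvPolynomial.aeval_X_left_apply p
  rw [this, hp _ W hW]

end UniversalGl

/-! ### The models: labels `ℕ`, points `Fin r`. -/

namespace UniversalGl

open Equiv

section Model

/-- The points `Fin r` among the labels and the points. -/
def pts (r : ℕ) : Finset (ℕ ⊕ Fin r) := Finset.univ.map Function.Embedding.inr

theorem inl_notMem_pts {r : ℕ} (i : ℕ) : (Sum.inl i : ℕ ⊕ Fin r) ∉ pts r := by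
  simp [pts]

theorem inr_mem_pts {r : ℕ} (a : Fin r) : (Sum.inr a : ℕ ⊕ Fin r) ∈ pts r := by
  simp [pts]

/-- An embedding of `Fin m` in the labels. -/
def labelEmb (r : ℕ) {m : ℕ} (f : Fin m ↪ ℕ) : Fin m ↪ ℕ ⊕ Fin r :=
  f.trans Function.Embedding.inl

/-- The standard embedding of `Fin m` in the labels. -/
def stdEmb (r m : ℕ) : Fin m ↪ ℕ ⊕ Fin r := labelEmb r Fin.valEmbedding

variable {R : Type*} [CommRing R] (ν c : R) (r : ℕ)

/-- The weight of a permutation of `Fin m` in the group algebra. -/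
noncomputable def finWeight (m : ℕ) (α : Perm (Fin m)) : PermAlg R (ℕ ⊕ Fin r) :=
  weight ν c (pts r) (List.ofFn (stdEmb r m)) (α.viaFintypeEmbedding (stdEmb r m))

theorem ofFn_labelEmb_notMem {m : ℕ} (f : Fin m ↪ ℕ) :
    ∀ x ∈ List.ofFn (labelEmb r f), x ∉ pts r := by
  intro x hx
  obtain ⟨i, rfl⟩ := List.mem_ofFn.1 hx
  exact inl_notMem_pts _

theorem weight_labelEmb {m : ℕ} (f : Fin m ↪ ℕ) (α : Perm (Fin m)) :
    weight ν c (pts r) (List.ofFn (labelEmb r f)) (α.viaFintypeEmbedding (labelEmb r f)) =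
      finWeight ν c r m α := by
  -- Any two injections of `Fin m` into the labels differ by a permutation of the labels, so
  -- `weight_relabel` applies.
  have := Perm.isMultiplyPretransitive ℕ m
  obtain ⟨g, hg⟩ := MulAction.exists_smul_eq (Perm ℕ) (Fin.valEmbedding : Fin m ↪ ℕ) f
  let σ : Perm (ℕ ⊕ Fin r) := sumCongr g 1
  have h1 : labelEmb r f = (stdEmb r m).trans σ.toEmbedding := by
    ext1 i
    rw [← hg]
    rfl
  have h2 : List.ofFn (labelEmb r f) = (List.ofFn (stdEmb r m)).map σ := by
    rw [h1, List.map_ofFn]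
    rfl
  rw [h2, h1, viaFintypeEmbedding_trans, weight_relabel ν c, finWeight]
  · exact fun t ht => viaFintypeEmbedding_apply_of_notMem _ _ ht
  · intro t ht
    rw [pts, Finset.mem_map] at ht
    obtain ⟨a, -, rfl⟩ := ht
    rfl

theorem finWeight_unit : finWeight ν c r 0 1 = 1 := by
  have : (1 : Perm (Fin 0)).viaFintypeEmbedding (stdEmb r 0) = 1 :=
    (eq_viaFintypeEmbedding _ _ _ (fun i => i.elim0) fun t _ => rfl).symm
  rw [finWeight, this]
  simp [weight, ltrace, jmProd]

theorem finWeight_commute {m n : ℕ} (α : Perm (Fin m)) (β : Perm (Fin n)) :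
    finWeight ν c r m α * finWeight ν c r n β = finWeight ν c r n β * finWeight ν c r m α :=
  weight_commute ν c (ofFn_labelEmb_notMem r Fin.valEmbedding)
    (fun _ ht => viaFintypeEmbedding_apply_of_notMem _ _ ht)
    (fun _ ht => viaFintypeEmbedding_apply_of_notMem _ _ ht)

theorem finWeight_multiplicative (m n : ℕ) (α : Perm (Fin m)) (β : Perm (Fin n)) :
    finWeight ν c r (m + n) (concat α β) = finWeight ν c r m α * finWeight ν c r n β := by
  have h1 : List.ofFn (stdEmb r (m + n)) =
      List.ofFn (labelEmb r ((Fin.castAddEmb n : Fin m ↪ Fin (m + n)).trans Fin.valEmbedding)) ++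
        List.ofFn (labelEmb r ((Fin.natAddEmb m : Fin n ↪ Fin (m + n)).trans Fin.valEmbedding)) := by
    rw [List.ofFn_add]
    rfl
  rw [finWeight, h1, viaFintypeEmbedding_concat, ← weight_labelEmb ν c r
    ((Fin.castAddEmb n).trans Fin.valEmbedding) α, ← weight_labelEmb ν c r
    ((Fin.natAddEmb m).trans Fin.valEmbedding) β]
  refine weight_append ν c (ofFn_labelEmb_notMem r _) (ofFn_labelEmb_notMem r _) ?_
    (fun _ ht => viaFintypeEmbedding_apply_of_notMem _ _ ht)
    (fun _ ht => viaFintypeEmbedding_apply_of_notMem _ _ ht)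
  intro t h1 h2
  obtain ⟨i, rfl⟩ := List.mem_ofFn.1 h1
  obtain ⟨j, hj⟩ := List.mem_ofFn.1 h2
  have : m + (j : ℕ) = i := Sum.inl_injective hj
  omega

theorem finWeight_recurrence (n : ℕ) (α : Perm (Fin (n + 1))) (k : Fin n) :
    finWeight ν c r (n + 1) α - finWeight ν c r (n + 1)
        (swap k.castSucc k.succ * α * swap k.castSucc k.succ) =
      loopWeight ν k.succ (α * swap k.castSucc k.succ) •
          finWeight ν c r n (deletePoint k.succ (α * swap k.castSucc k.succ)) -
        loopWeight ν k.castSucc (α * swap k.castSucc k.succ) •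
          finWeight ν c r n (deletePoint k.castSucc (α * swap k.castSucc k.succ)) := by
  set e := stdEmb r (n + 1) with he
  set β := α * swap k.castSucc k.succ with hβ
  obtain ⟨l, l', h1, h2, h3⟩ := exists_ofFn_eq_append e k
  have hn : (List.ofFn e).Nodup := List.nodup_ofFn.2 e.injective
  have hA := ofFn_labelEmb_notMem r (Fin.valEmbedding : Fin (n + 1) ↪ ℕ)
  have hd : ∀ j : Fin (n + 1), deleteEmb e j =
      labelEmb r ((Fin.succAboveEmb j).trans (Fin.valEmbedding : Fin (n + 1) ↪ ℕ)) := fun j => rfl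
  have hl : ∀ j : Fin (n + 1), loopWeight ν (e j) (β.viaFintypeEmbedding e) = loopWeight ν j β := by
    intro j
    simp [loopWeight]
  have key := weight_recurrence ν c (h1 ▸ hn) (h1 ▸ hA) (α.viaFintypeEmbedding e)
  rw [← h1, ← viaFintypeEmbedding_swap, ← viaFintypeEmbedding_mul, ← viaFintypeEmbedding_mul,
    ← viaFintypeEmbedding_mul, ← hβ, hl, hl, isolate_viaFintypeEmbedding,
    isolate_viaFintypeEmbedding, ← h2, ← h3] at key
  rw [finWeight, finWeight, ← he, key, ← weight_labelEmb ν c r ((Fin.succAboveEmb k.succ).trans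
    (Fin.valEmbedding : Fin (n + 1) ↪ ℕ)), ← weight_labelEmb ν c r ((Fin.succAboveEmb
    k.castSucc).trans (Fin.valEmbedding : Fin (n + 1) ↪ ℕ)), ← hd, ← hd]
  rfl

/-- The first Casimir is a scalar in each model. The parameter `c` is there so that this scalar can
be transcendental over `ℂ[N]`. -/
theorem finWeight_one : finWeight ν c r 1 (finRotate 1) = algebraMap R _ (ν * c + r) := by
  have h : (finRotate 1).viaFintypeEmbedding (stdEmb r 1) = 1 := by
    rw [viaFintypeEmbedding_finRotate]
    rfl
  have h1 : ptrace ν (Sum.inl 0 : ℕ ⊕ Fin r) (algebraMap R _ c) = algebraMap R _ (ν * c) := by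
    rw [ptrace_of_mem_supp ν (S := ∅) (Subalgebra.algebraMap_mem _ _) (Set.notMem_empty _),
      map_mul, Algebra.smul_def]
  rw [finWeight, h, weight, map_one, one_mul]
  simp only [List.ofFn_succ, List.ofFn_zero]
  rw [ltrace_cons, ltrace_nil]
  change ptrace ν (Sum.inl 0) (jmProd c (pts r) [Sum.inl 0]) = _
  rw [jmProd_cons, jmProd, List.map_nil, List.prod_nil, mul_one, jm, map_add, h1, map_sum,
    Finset.sum_congr rfl fun a ha => ptrace_swap ν fun h => inl_notMem_pts 0 (h ▸ ha), map_add]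
  simp [pts]

end Model

/-! ### Leading coefficients of weights at derangements of the points. -/

section Coefficients

variable {R : Type*} [CommRing R]

theorem coeff_ofPerm {T : Type*} [DecidableEq (Perm T)] (π σ : Perm T) :
    (ofPerm R π).coeff σ = if π = σ then 1 else 0 :=
  Finsupp.single_apply

theorem coeff_eq_zero_of_mem_supp {T : Type*} {S : Set T} {u : PermAlg R T} (hu : u ∈ supp R S)
    {σ : Perm T} {t : T} (ht : t ∉ S) (hσ : σ t ≠ t) : u.coeff σ = 0 := by
  classical
  induction hu using supp_induction with
  | of π hπ => rw [coeff_ofPerm, if_neg fun h : π = σ => hσ (h ▸ hπ t ht)]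
  | add u v _ _ hu hv => simp [hu, hv]
  | smul a u _ hu => simp [hu]

variable (ν c : R) {r : ℕ}

/-- A summand of `jm`: either the constant or a transposition. -/
noncomputable def jmTerm (x : ℕ) : Option (Fin r) → PermAlg R (ℕ ⊕ Fin r)
  | none => algebraMap R _ c
  | some a => ofPerm R (swap (Sum.inl x) (Sum.inr a))

theorem jm_eq_sum (x : ℕ) :
    jm c (pts r) (Sum.inl x) = ∑ o : Option (Fin r), jmTerm c x o := by
  rw [Fintype.sum_option, jm, pts, Finset.sum_map]
  rfl

/-- A summand in the expansion of `finWeight`. -/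
noncomputable def termTrace {m : ℕ} (α : Perm (Fin m)) (f : Fin m → Option (Fin r)) :
    PermAlg R (ℕ ⊕ Fin r) :=
  ltrace ν (List.ofFn (stdEmb r m)) (ofPerm R (α.viaFintypeEmbedding (stdEmb r m)) *
    (List.ofFn fun i => jmTerm c (i : ℕ) (f i)).prod)

theorem finWeight_eq_sum {m : ℕ} (α : Perm (Fin m)) :
    finWeight ν c r m α = ∑ f : Fin m → Option (Fin r),
      termTrace ν c α f := by
  have h : jmProd c (pts r) (List.ofFn (stdEmb r m)) =
      ∑ f : Fin m → Option (Fin r), (List.ofFn fun i => jmTerm c (i : ℕ) (f i)).prod := by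
    have := (MultilinearMap.mkPiAlgebraFin R m (PermAlg R (ℕ ⊕ Fin r))).map_sum
      fun (i : Fin m) (o : Option (Fin r)) => jmTerm c (i : ℕ) o
    simp only [MultilinearMap.mkPiAlgebraFin_apply] at this
    rw [← this, jmProd, List.map_ofFn]
    congr 2
    ext1 i
    exact jm_eq_sum c i
  rw [finWeight, weight, h, Finset.mul_sum, ltrace_sum]
  rfl

theorem ltrace_term_mem_supp {m : ℕ} (α : Perm (Fin m)) (f : Fin m → Option (Fin r)) {a : Fin r}
    (ha : ∀ i, f i ≠ some a) :
    termTrace ν c α f ∈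
      supp R ({Sum.inr a}ᶜ : Set (ℕ ⊕ Fin r)) := by
  refine supp_mono Set.sdiff_subset (ltrace_mem_supp ν _ (mul_mem ?_ (list_prod_mem ?_)))
  · refine ofPerm_mem_supp fun t ht => viaFintypeEmbedding_apply_of_notMem _ _ fun h => ?_
    obtain rfl : t = Sum.inr a := by simpa using ht
    exact ofFn_labelEmb_notMem r _ _ h (inr_mem_pts a)
  · intro u hu
    obtain ⟨i, rfl⟩ := List.mem_ofFn.1 hu
    cases hf : f i with
    | none => exact Subalgebra.algebraMap_mem _ _
    | some b =>
      refine ofPerm_mem_supp fun t ht => ?_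
      obtain rfl : t = Sum.inr a := by simpa using ht
      refine swap_apply_of_ne_of_ne Sum.inr_ne_inl fun h => ha i ?_
      rw [hf, Sum.inr_injective h]

/-- The product of the transpositions exchanging the label `i` and the point `g i`. -/
def exchange (g : Perm (Fin r)) (l : List (Fin r)) : Perm (ℕ ⊕ Fin r) :=
  (l.map fun i : Fin r => swap (Sum.inl (i : ℕ)) (Sum.inr (g i))).prod

theorem exchange_of_notMem (g : Perm (Fin r)) {l : List (Fin r)} {t : ℕ ⊕ Fin r}
    (ht : ∀ i ∈ l, t ≠ Sum.inl (i : ℕ) ∧ t ≠ Sum.inr (g i)) : exchange g l t = t := by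
  induction l with
  | nil => rfl
  | cons i l ih =>
    rw [exchange, List.map_cons, List.prod_cons, Perm.mul_apply, ← exchange,
      ih fun j hj => ht j (List.mem_cons_of_mem _ hj),
      swap_apply_of_ne_of_ne (ht i List.mem_cons_self).1 (ht i List.mem_cons_self).2]

theorem exchange_apply (g : Perm (Fin r)) {l : List (Fin r)} (hl : l.Nodup) {i : Fin r}
    (hi : i ∈ l) : exchange g l (Sum.inl (i : ℕ)) = Sum.inr (g i) ∧
      exchange g l (Sum.inr (g i)) = Sum.inl (i : ℕ) := by
  induction l with
  | nil => simp at hi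
  | cons j l ih =>
    rw [exchange, List.map_cons, List.prod_cons, Perm.mul_apply, Perm.mul_apply, ← exchange]
    rw [List.nodup_cons] at hl
    rcases List.mem_cons.1 hi with rfl | hi
    · have h1 : ∀ k ∈ l, i ≠ k := fun k hk h => hl.1 (h ▸ hk)
      rw [exchange_of_notMem g fun k hk => ⟨fun h => h1 k hk (Fin.ext (Sum.inl_injective h)),
        Sum.inl_ne_inr⟩, exchange_of_notMem g fun k hk => ⟨Sum.inr_ne_inl,
        fun h => h1 k hk (g.injective (Sum.inr_injective h))⟩]
      simp
    · have hij : i ≠ j := fun h => hl.1 (h ▸ hi)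
      rw [(ih hl.2 hi).1, (ih hl.2 hi).2]
      refine ⟨swap_apply_of_ne_of_ne Sum.inr_ne_inl fun h => hij (g.injective
        (Sum.inr_injective h)), swap_apply_of_ne_of_ne (fun h => hij (Fin.ext
        (Sum.inl_injective h))) Sum.inl_ne_inr⟩

theorem ltrace_exchange (g : Perm (Fin r)) {l : List (Fin r)} (hl : l.Nodup) :
    ltrace ν (l.map fun i : Fin r => (Sum.inl (i : ℕ) : ℕ ⊕ Fin r)) (ofPerm R (exchange g l)) = 1 := by
  induction l with
  | nil => simp [ltrace, exchange]
  | cons i l ih =>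
    rw [List.nodup_cons] at hl
    have h1 : ofPerm R (exchange g l) ∈ supp R ({Sum.inl (i : ℕ)}ᶜ : Set (ℕ ⊕ Fin r)) := by
      refine ofPerm_mem_supp fun t ht => exchange_of_notMem g fun k hk => ?_
      obtain rfl : t = Sum.inl (i : ℕ) := by simpa using ht
      exact ⟨fun h => hl.1 (Fin.ext (Sum.inl_injective h) ▸ hk), Sum.inl_ne_inr⟩
    rw [exchange, List.map_cons, List.map_cons, List.prod_cons, ← exchange, ltrace_cons', map_mul,
      ptrace_mul_right ν _ h1 (by simp), ptrace_swap ν Sum.inl_ne_inr, one_mul, ih hl.2]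

/-- The product `θ` of the transpositions exchanging each label with its own point carries `α` from
the labels to its copy on the points; the trace of the remaining `θ` over the labels is `1`. -/
theorem ltrace_term_bijective (α g : Perm (Fin r)) :
    termTrace ν c α (fun i => some (g i)) =
      ofPerm R (sumCongr 1 (g * α * g⁻¹)) := by
  set π := α.viaFintypeEmbedding (stdEmb r r) with hπ
  set θ := exchange g (List.finRange r) with hθ
  have h1 : (List.ofFn fun i => jmTerm c (i : ℕ) (some (g i))).prod = ofPerm R θ := by
    rw [hθ, exchange, map_list_prod, List.map_map, List.ofFn_eq_map]
    rfl
  have happ := fun i => exchange_apply g (List.nodup_finRange r) (List.mem_finRange i)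
  have h2 : π * θ = θ * sumCongr 1 (g * α * g⁻¹) := by
    ext1 t
    rw [Perm.mul_apply, Perm.mul_apply]
    rcases t with n | a
    · by_cases hn : n < r
      · have e1 := (happ ⟨n, hn⟩).1
        simp only at e1
        rw [sumCongr_apply, Sum.map_inl, Perm.one_apply, hθ, e1, hπ,
          viaFintypeEmbedding_apply_of_notMem]
        exact fun h => ofFn_labelEmb_notMem r _ _ h (inr_mem_pts _)
      · have e1 : θ (Sum.inl n) = Sum.inl n := by
          refine exchange_of_notMem g fun i _ => ⟨fun h => hn ?_, Sum.inl_ne_inr⟩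
          rw [Sum.inl_injective h]
          exact i.2
        rw [sumCongr_apply, Sum.map_inl, Perm.one_apply, e1, hπ,
          viaFintypeEmbedding_apply_of_notMem]
        intro h
        obtain ⟨i, hi⟩ := List.mem_ofFn.1 h
        exact hn ((Sum.inl_injective hi : (i : ℕ) = n) ▸ i.2)
    · obtain ⟨i, rfl⟩ := g.surjective a
      have e2 := Perm.viaFintypeEmbedding_apply_image α (stdEmb r r) i
      rw [sumCongr_apply, Sum.map_inr, hθ, (happ i).2, Perm.mul_apply, Perm.mul_apply,
        show g⁻¹ (g i) = i by simp, (happ (α i)).2, hπ]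
      exact e2
  have h3 : List.ofFn (stdEmb r r) =
      (List.finRange r).map fun i : Fin r => (Sum.inl (i : ℕ) : ℕ ⊕ Fin r) := by
    rw [List.ofFn_eq_map]
    rfl
  rw [termTrace, h1, ← map_mul, h2, map_mul, ltrace_mul_right ν (S := (pts r : Set (ℕ ⊕ Fin r))), h3,
    ltrace_exchange ν g (List.nodup_finRange r), one_mul]
  · refine ofPerm_mem_supp fun t ht => ?_
    rcases t with n | a
    · rfl
    · exact absurd (inr_mem_pts a) ht
  · exact ofFn_labelEmb_notMem r _

/-- With fewer labels than points, each summand misses some point and so fixes it, while `τ` moves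
every point. -/
theorem coeff_finWeight_of_lt {m : ℕ} (hm : m < r) (α : Perm (Fin m)) {τ : Perm (Fin r)}
    (hτ : ∀ a, τ a ≠ a) : (finWeight ν c r m α).coeff (sumCongr 1 τ) = 0 := by
  rw [finWeight_eq_sum, MonoidAlgebra.coeff_sum, Finsupp.finsetSum_apply]
  refine Finset.sum_eq_zero fun f _ => ?_
  obtain ⟨a, ha⟩ : ∃ a, ∀ i, f i ≠ some a := by
    by_contra! h
    choose i hi using h
    have : Function.Injective i := fun a b hab => by
      have := (hi a).symm.trans (hab ▸ hi b)
      exact Option.some_injective _ this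
    have := Fintype.card_le_of_injective i this
    simp at this
    omega
  refine coeff_eq_zero_of_mem_supp (ltrace_term_mem_supp ν c α f ha) (t := Sum.inr a) (by simp) ?_
  exact fun h => hτ a (Sum.inr_injective h)

theorem coeff_finWeight_term (α : Perm (Fin r)) {τ : Perm (Fin r)} (hτ : ∀ a, τ a ≠ a)
    (f : Fin r → Option (Fin r)) :
    (termTrace ν c α f).coeff (sumCongr 1 τ) = 0 ∨
    (termTrace ν c α f).coeff (sumCongr 1 τ) = 1 ∧
      IsConj α τ := by
  classical
  by_cases h : ∃ a, ∀ i, f i ≠ some a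
  · obtain ⟨a, ha⟩ := h
    left
    refine coeff_eq_zero_of_mem_supp (ltrace_term_mem_supp ν c α f ha) (t := Sum.inr a) (by simp) ?_
    exact fun h => hτ a (Sum.inr_injective h)
  · push Not at h
    choose i hi using h
    have hinj : Function.Injective i := fun a b hab => by
      have := (hi a).symm.trans (hab ▸ hi b)
      exact Option.some_injective _ this
    let g : Perm (Fin r) := (Equiv.ofBijective i (Finite.injective_iff_bijective.1 hinj)).symm
    have hf : f = fun j => some (g j) := by
      ext1 j
      rw [← hi (g j)]
      congr 1
      exact ((Equiv.ofBijective i (Finite.injective_iff_bijective.1 hinj)).apply_symm_apply j).symm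
    rw [hf, ltrace_term_bijective, coeff_ofPerm]
    split_ifs with h
    · refine Or.inr ⟨rfl, isConj_iff.2 ⟨g, ?_⟩⟩
      ext1 a
      exact Sum.inr_injective (congrArg (fun σ : Perm (ℕ ⊕ Fin r) => σ (Sum.inr a)) h)
    · exact Or.inl rfl

theorem coeff_finWeight_of_not_isConj (α : Perm (Fin r)) {τ : Perm (Fin r)} (hτ : ∀ a, τ a ≠ a)
    (h : ¬IsConj α τ) : (finWeight ν c r r α).coeff (sumCongr 1 τ) = 0 := by
  rw [finWeight_eq_sum, MonoidAlgebra.coeff_sum, Finsupp.finsetSum_apply]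
  refine Finset.sum_eq_zero fun f _ => ?_
  exact (coeff_finWeight_term ν c α hτ f).resolve_right fun h' => h h'.2

/-- Each summand contributes `0` or `1`, so the coefficient is a count; assigning to each label the
point of the same number contributes `1`. -/
theorem coeff_finWeight_self {τ : Perm (Fin r)} (hτ : ∀ a, τ a ≠ a) :
    ∃ n : ℕ, n ≠ 0 ∧ (finWeight ν c r r τ).coeff (sumCongr 1 τ) = (n : R) := by
  classical
  rw [finWeight_eq_sum, MonoidAlgebra.coeff_sum, Finsupp.finsetSum_apply]
  set x := fun f : Fin r → Option (Fin r) =>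
    (termTrace ν c τ f).coeff (sumCongr 1 τ) with hx
  have h1 : x some = 1 := by
    have := ltrace_term_bijective ν c τ 1
    simp only [Perm.one_apply, one_mul, inv_one, mul_one] at this
    rw [hx]
    simp only
    rw [this, coeff_ofPerm, if_pos rfl]
  refine ⟨∑ f : Fin r → Option (Fin r), if x f = 1 then 1 else 0, ?_, ?_⟩
  · refine (Finset.sum_pos' (fun _ _ => Nat.zero_le _) ⟨some, Finset.mem_univ _, ?_⟩).ne'
    simp [h1]
  · rw [Nat.cast_sum]
    refine Finset.sum_congr rfl fun f _ => ?_
    rcases coeff_finWeight_term ν c τ hτ f with h | h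
    · change x f = 0 at h
      rw [h]
      split_ifs with h0
      · simpa using h0
      · simp
    · have := h.1
      change x f = 1 at this
      simp [this]

end Coefficients

end UniversalGl

/-! ### The model rings, existence, and the relation between cycles and their inverses. -/

namespace UniversalGl

open Equiv

section ModelRing

/-- The value of `N` in the models. -/
noncomputable def modelN : Polynomial (Polynomial ℂ) := Polynomial.C Polynomial.X

/-- The weights of permutations in the group algebra over `ℂ[N][c]`. -/
noncomputable abbrev modelElt (r : ℕ) (p : Σ m, Perm (Fin m)) :
    PermAlg (Polynomial (Polynomial ℂ)) (ℕ ⊕ Fin r) :=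
  finWeight modelN Polynomial.X r p.1 p.2

/-- The algebra generated by all weights of permutations. -/
noncomputable abbrev modelAlg (r : ℕ) :
    Subalgebra (Polynomial ℂ) (PermAlg (Polynomial (Polynomial ℂ)) (ℕ ⊕ Fin r)) :=
  Algebra.adjoin (Polynomial ℂ) (Set.range (modelElt r))

/-- The commutative ring generated by all weights of permutations. -/
def ModelRing (r : ℕ) : Type := modelAlg r

noncomputable instance (r : ℕ) : CommRing (ModelRing r) :=
  { (inferInstance : Ring (modelAlg r)) with
    mul_comm := by
      have := Algebra.isMulCommutative_adjoin (Polynomial ℂ) (s := Set.range (modelElt r))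
        (by
          rintro _ ⟨p, rfl⟩ _ ⟨q, rfl⟩
          exact finWeight_commute _ _ _ _ _)
      exact fun a b => this.is_comm.comm a b }

noncomputable instance (r : ℕ) : Algebra (Polynomial ℂ) (ModelRing r) :=
  RingHom.toAlgebra (algebraMap (Polynomial ℂ) (modelAlg r))

/-- The inclusion of the model ring in the group algebra. -/
noncomputable def ModelRing.val (r : ℕ) :
    ModelRing r →+* PermAlg (Polynomial (Polynomial ℂ)) (ℕ ⊕ Fin r) :=
  ((modelAlg r).val : modelAlg r →+* _)

theorem ModelRing.val_injective (r : ℕ) : Function.Injective (ModelRing.val r) :=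
  Subtype.val_injective

theorem ModelRing.val_algebraMap (r : ℕ) (a : Polynomial ℂ) :
    ModelRing.val r (algebraMap _ _ a) = algebraMap (Polynomial (Polynomial ℂ)) _ (.C a) :=
  rfl

/-- The weight of a permutation as an element of the model ring. -/
noncomputable def modelWeight (r m : ℕ) (α : Perm (Fin m)) : ModelRing r :=
  (⟨modelElt r ⟨m, α⟩, Algebra.subset_adjoin ⟨_, rfl⟩⟩ : modelAlg r)

theorem ModelRing.val_modelWeight (r m : ℕ) (α : Perm (Fin m)) :
    ModelRing.val r (modelWeight r m α) = finWeight modelN Polynomial.X r m α := rfl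

theorem isWeightSystem_modelWeight (r : ℕ) :
    IsWeightSystem (algebraMap (Polynomial ℂ) (ModelRing r) Polynomial.X) (modelWeight r) where
  unit := ModelRing.val_injective r (by
    rw [ModelRing.val_modelWeight, finWeight_unit, map_one])
  multiplicative m n α β := ModelRing.val_injective r (by
    rw [map_mul]
    exact finWeight_multiplicative _ _ _ _ _ _ _)
  recurrence n α k := ModelRing.val_injective r (by
    have hl : ∀ (j : Fin (n + 1)) (β : Perm (Fin (n + 1))),
        ModelRing.val r (loopWeight (algebraMap (Polynomial ℂ) (ModelRing r) Polynomial.X) j β) =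
          algebraMap (Polynomial (Polynomial ℂ)) _ (loopWeight modelN j β) := by
      intro j β
      rw [loopWeight, loopWeight]
      split_ifs
      · rfl
      · rw [map_one, map_one]
    simp only [map_sub, map_mul, hl, ModelRing.val_modelWeight]
    rw [finWeight_recurrence, Algebra.smul_def, Algebra.smul_def])

/-- The evaluation of universal polynomials in the model ring. -/
noncomputable def modelEval (r : ℕ) : PolyRing →ₐ[Polynomial ℂ] ModelRing r :=
  MvPolynomial.aeval fun k : ℕ+ => modelWeight r k (finRotate k)

/-- A monomial in the Casimirs is the weight of a concatenation of cycles. Without `C₁` there are no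
fixed points, so the cycle type remembers the monomial. -/
theorem exists_perm_of_multiset (r : ℕ) (s : Multiset ℕ+) (hs : ∀ k ∈ s, k ≠ 1) :
    ∃ m, ∃ α : Perm (Fin m), m = (s.map ((↑) : ℕ+ → ℕ)).sum ∧
      α.cycleType = s.map ((↑) : ℕ+ → ℕ) ∧
      modelWeight r m α = (s.map fun k : ℕ+ => modelWeight r k (finRotate k)).prod := by
  induction s using Multiset.induction_on with
  | empty =>
    refine ⟨0, 1, by simp, by simp, ?_⟩
    rw [(isWeightSystem_modelWeight r).unit]
    simp
  | cons k s ih =>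
    obtain ⟨m, α, hm, hc, hw⟩ := ih fun j hj => hs j (Multiset.mem_cons_of_mem hj)
    refine ⟨m + k, concat α (finRotate k), ?_, ?_, ?_⟩
    · rw [Multiset.map_cons, Multiset.sum_cons, hm, add_comm]
    · have hk : 2 ≤ (k : ℕ) := by
        have h1 := hs k (Multiset.mem_cons_self k s)
        have h2 := k.pos
        have h3 : (k : ℕ) ≠ 1 := fun h => h1 (PNat.coe_eq_one_iff.1 h)
        omega
      rw [cycleType_concat, hc, cycleType_finRotate_of_le hk, Multiset.map_cons, add_comm,
        Multiset.singleton_add]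
    · rw [(isWeightSystem_modelWeight r).multiplicative, hw, Multiset.map_cons, Multiset.prod_cons,
        mul_comm]

theorem modelWeight_one (r : ℕ) : ModelRing.val r (modelWeight r 1 (finRotate 1)) =
    algebraMap (Polynomial (Polynomial ℂ)) _
      (modelN * Polynomial.X + ((r : ℕ) : Polynomial (Polynomial ℂ))) :=
  finWeight_one _ _ _

theorem coeff_val_modelEval (r : ℕ) (p : PolyRing) (σ : Perm (ℕ ⊕ Fin r)) :
    (ModelRing.val r (modelEval r p)).coeff σ =
      ∑ d ∈ p.support, Polynomial.C (p.coeff d) *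
        (modelN * Polynomial.X + ((r : ℕ) : Polynomial (Polynomial ℂ))) ^ d 1 *
        (ModelRing.val r (((d.erase 1).toMultiset.map
          fun k : ℕ+ => modelWeight r k (finRotate k)).prod)).coeff σ := by
  have h : modelEval r p = ∑ d ∈ p.support, algebraMap _ _ (p.coeff d) *
      d.prod fun k n => modelWeight r k (finRotate k) ^ n := by
    rw [modelEval, MvPolynomial.aeval_def, MvPolynomial.eval₂_eq]
    rfl
  rw [h, map_sum, MonoidAlgebra.coeff_sum, Finsupp.finsetSum_apply]
  refine Finset.sum_congr rfl fun d _ => ?_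
  have h1 : (d.prod fun (k : ℕ+) n => modelWeight r k (finRotate k) ^ n) =
      modelWeight r 1 (finRotate 1) ^ d 1 *
        ((d.erase 1).toMultiset.map fun k : ℕ+ => modelWeight r k (finRotate k)).prod := by
    rw [← Finsupp.mul_prod_erase' d 1 _ fun _ => pow_zero _, Finsupp.toMultiset_map,
      Finsupp.prod_toMultiset, Finsupp.prod_mapDomain_index (fun _ => pow_zero _)
      fun _ _ _ => pow_add _ _ _]
    rfl
  rw [h1, map_mul, map_mul, map_pow, modelWeight_one, ModelRing.val_algebraMap, ← map_pow,
    ← mul_assoc, ← map_mul, ← Algebra.smul_def, MonoidAlgebra.coeff_smul_apply, smul_eq_mul]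

/-- A universal polynomial that vanishes in all models is zero. -/
theorem eq_zero_of_modelEval (p : PolyRing) (h : ∀ r, modelEval r p = 0) : p = 0 := by
  by_contra hp
  have hne : p.support.Nonempty := by
    rwa [Finset.nonempty_iff_ne_empty, Ne, MvPolynomial.support_eq_empty]
  let wt : (ℕ+ →₀ ℕ) → ℕ := fun e => (e.toMultiset.map ((↑) : ℕ+ → ℕ)).sum
  obtain ⟨d₀, hd₀, hmax⟩ := p.support.exists_max_image (fun d => wt (d.erase 1)) hne
  have hs : ∀ d : ℕ+ →₀ ℕ, ∀ k ∈ (d.erase 1).toMultiset, k ≠ 1 := by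
    rintro d k hk rfl
    rw [Finsupp.mem_toMultiset] at hk
    simp at hk
  -- The number of points is the largest weight of a monomial once `C₁` is dropped, so that this
  -- monomial belongs to a derangement `τ` of all `r` points.
  set r := wt (d₀.erase 1) with hr
  obtain ⟨m, τ, hm, hc, hw⟩ := exists_perm_of_multiset r _ (hs d₀)
  obtain rfl : m = r := hm
  have hτ : ∀ a, τ a ≠ a := by
    have h1 : τ.support = Finset.univ := by
      rw [← Finset.card_eq_iff_eq_univ, ← Perm.sum_cycleType, hc, Fintype.card_fin]
    intro a
    rw [← Perm.mem_support, h1]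
    exact Finset.mem_univ a
  obtain ⟨z, hz, hz'⟩ := coeff_finWeight_self modelN Polynomial.X hτ
  rw [← ModelRing.val_modelWeight, hw] at hz'
  -- The other monomials do not reach `τ`: they have either too few labels or a different cycle
  -- type.
  have h0 : ∀ d ∈ p.support, d.erase 1 ≠ d₀.erase 1 → (ModelRing.val _
      (((d.erase 1).toMultiset.map fun k : ℕ+ =>
        modelWeight (wt (d₀.erase 1)) k (finRotate k)).prod)).coeff (sumCongr 1 τ) = 0 := by
    intro d hd hne
    obtain ⟨m', α, hm', hc', hw'⟩ := exists_perm_of_multiset (wt (d₀.erase 1)) _ (hs d)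
    rw [← hw', ModelRing.val_modelWeight]
    have hle : m' ≤ wt (d₀.erase 1) := hm' ▸ hmax d hd
    rcases hle.lt_or_eq with hlt | rfl
    · exact coeff_finWeight_of_lt _ _ hlt α hτ
    · refine coeff_finWeight_of_not_isConj _ _ α hτ fun hcon => hne ?_
      rw [Perm.isConj_iff_cycleType_eq, hc, hc'] at hcon
      exact Multiset.toFinsupp.symm.injective (Multiset.map_injective PNat.coe_injective hcon)
  have hsum := coeff_val_modelEval (wt (d₀.erase 1)) p (sumCongr 1 τ)
  rw [h, map_zero, ← Finset.sum_filter_add_sum_filter_not p.support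
    (fun d => d.erase 1 = d₀.erase 1), Finset.sum_eq_zero (s := p.support.filter fun d =>
    ¬d.erase 1 = d₀.erase 1), add_zero] at hsum
  swap
  · intro d hd
    rw [Finset.mem_filter] at hd
    rw [h0 d hd.1 hd.2, mul_zero]
  -- The surviving monomials differ only in the exponent of `C₁`. They form a polynomial `q` in `C₁
  -- = N c + r`, which is not constant in `c`, so vanishing of the value forces `q = 0`.
  let q : Polynomial (Polynomial ℂ) := ∑ d ∈ p.support with d.erase 1 = d₀.erase 1,
    Polynomial.C (p.coeff d) * Polynomial.X ^ d 1
  have hq : q.comp (modelN * Polynomial.X + ((wt (d₀.erase 1) : ℕ) : Polynomial (Polynomial ℂ))) *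
      (z : Polynomial (Polynomial ℂ))
      = 0 := by
    rw [Polynomial.sum_comp, Finset.sum_mul]
    refine Eq.trans (Finset.sum_congr rfl fun d hd => ?_) hsum.symm
    rw [Finset.mem_filter] at hd
    rw [hd.2, hz']
    simp
  have hq0 : q = 0 := by
    rcases mul_eq_zero.1 hq with hq | hq
    · rcases Polynomial.comp_eq_zero_iff.1 hq with hq | hq
      · exact hq
      · exfalso
        have := congrArg (fun f => Polynomial.coeff f 1) hq.2
        simp [modelN, Polynomial.coeff_natCast_ite] at this
    · exact absurd hq (Nat.cast_ne_zero.2 hz)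
  have hcoeff := congrArg (fun f => Polynomial.coeff f (d₀ 1)) hq0
  simp only [q, Polynomial.finsetSum_coeff, Polynomial.coeff_C_mul, Polynomial.coeff_X_pow,
    Polynomial.coeff_zero] at hcoeff
  rw [Finset.sum_eq_single d₀] at hcoeff
  · rw [if_pos rfl, mul_one] at hcoeff
    exact (MvPolynomial.mem_support_iff.1 hd₀) hcoeff
  · intro d hd hne
    rw [Finset.mem_filter] at hd
    rw [if_neg, mul_zero]
    intro h1
    refine hne (Finsupp.ext fun k => ?_)
    by_cases hk : k = 1
    · rw [hk, h1]
    · have := DFunLike.congr_fun hd.2 k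
      rwa [Finsupp.erase_ne hk, Finsupp.erase_ne hk] at this
  · intro h1
    exact (h1 (Finset.mem_filter.2 ⟨hd₀, rfl⟩)).elim

theorem eq_of_modelEval {p q : PolyRing} (h : ∀ r, modelEval r p = modelEval r q) : p = q :=
  sub_eq_zero.1 (eq_zero_of_modelEval _ fun r => by rw [map_sub, h, sub_self])

theorem modelEval_N (r : ℕ) :
    modelEval r N = algebraMap (Polynomial ℂ) (ModelRing r) Polynomial.X := by
  simp [modelEval, N]

/-- The universal polynomials satisfy the relations because they do so in every model and the models
separate polynomials. -/
theorem exists_isGlWeightSystem : ∃ w, IsGlWeightSystem w := by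
  choose w hw using exists_poly
  have hw' : ∀ r m α, modelEval r (w m α) = modelWeight r m α := fun r m α =>
    (hw m α (ModelRing r) _ (isWeightSystem_modelWeight r)).symm
  refine ⟨w, fun m n α β => eq_of_modelEval fun r => ?_, fun m => eq_of_modelEval fun r => ?_,
    fun n α k => eq_of_modelEval fun r => ?_⟩
  · rw [map_mul, hw', hw', hw', (isWeightSystem_modelWeight r).multiplicative]
  · rw [hw', modelEval, MvPolynomial.aeval_X]
  · have hl : ∀ (j : Fin (n + 1)) (β : Perm (Fin (n + 1))), modelEval r (loopFactor j β) =
        loopWeight (algebraMap (Polynomial ℂ) (ModelRing r) Polynomial.X) j β := by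
      intro j β
      rw [loopFactor, loopWeight]
      split_ifs
      · exact modelEval_N r
      · simp
    simp only [map_sub, map_mul, hw', hl]
    exact (isWeightSystem_modelWeight r).recurrence n α k

theorem IsGlWeightSystem.modelEval {w : (m : ℕ) → Perm (Fin m) → PolyRing}
    (hw : IsGlWeightSystem w) (r m : ℕ) (α : Perm (Fin m)) :
    modelEval r (w m α) = modelWeight r m α :=
  (hw.eq_aeval (isWeightSystem_modelWeight r) m α).symm

/-- The value of a weight system at the inverses of the standard cycles, `N` for the empty one. -/
noncomputable def invCycle (w : (m : ℕ) → Perm (Fin m) → PolyRing) (k : ℕ) : PolyRing :=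
  if k = 0 then N else w k (finRotate k)⁻¹

/-- The relation between the values at standard cycles and at their inverses. -/
theorem IsGlWeightSystem.X_eq_cyclePoly {w : (m : ℕ) → Perm (Fin m) → PolyRing}
    (hw : IsGlWeightSystem w) (k : ℕ+) :
    (MvPolynomial.X k : PolyRing) = cyclePoly N (invCycle w) k 0 := by
  refine eq_of_modelEval fun r => ModelRing.val_injective r ?_
  have hνN : ((ModelRing.val r).comp (UniversalGl.modelEval r : PolyRing →+* ModelRing r)) N =
      algebraMap (Polynomial (Polynomial ℂ)) _ modelN := by
    rw [RingHom.comp_apply, RingHom.coe_coe, modelEval_N, ModelRing.val_algebraMap]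
    rfl
  -- Label `n` is not among the first `n` labels. Put in front with exponent `0`, it can be removed
  -- from a cycle, so the cycle of length `n` is a cycle trace whose tail has length exactly `n`.
  have hfresh : ∀ n : ℕ, (Sum.inl n :: List.ofFn (stdEmb r n)).Nodup ∧
      ∀ z ∈ Sum.inl n :: List.ofFn (stdEmb r n), z ∉ pts r := by
    intro n
    refine ⟨List.nodup_cons.2 ⟨fun h => ?_, List.nodup_ofFn.2 (stdEmb r n).injective⟩, fun z hz => ?_⟩
    · obtain ⟨i, hi⟩ := List.mem_ofFn.1 h
      exact i.2.ne (Sum.inl_injective hi)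
    · rcases List.mem_cons.1 hz with rfl | hz
      · exact inl_notMem_pts _
      · exact ofFn_labelEmb_notMem r _ z hz
  have hD : ∀ j, ∀ x ∉ pts r,
      ((ModelRing.val r).comp (UniversalGl.modelEval r : PolyRing →+* ModelRing r))
        (invCycle w j) = powerTrace modelN Polynomial.X (pts r) x j := by
    intro j x hx
    cases j with
    | zero =>
      rw [invCycle, if_pos rfl, hνN, powerTrace, pow_zero,
        ptrace_of_mem_supp (S := ∅) _ (one_mem _) (Set.notMem_empty _), Algebra.smul_def, mul_one]
    | succ j =>
      obtain ⟨h1, h2⟩ := hfresh (j + 1)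
      have h3 := invCycleTrace_eq_powerTrace modelN Polynomial.X h1 h2 0
      rw [List.length_ofFn, zero_add, powerTrace_eq _ _ (inl_notMem_pts _) hx] at h3
      rw [← h3, invCycle, if_neg (Nat.succ_ne_zero j), RingHom.comp_apply, RingHom.coe_coe,
        hw.modelEval, ModelRing.val_modelWeight, finWeight, viaFintypeEmbedding_inv,
        viaFintypeEmbedding_finRotate]
      rw [List.ofFn_succ] at h1 h2 ⊢
      rw [invCycleTrace_cons_zero _ _ h1 h2]
  obtain ⟨j, rfl⟩ : ∃ j : ℕ, k = j.succPNat := ⟨k.natPred, (PNat.succPNat_natPred k).symm⟩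
  obtain ⟨h1, h2⟩ := hfresh (j + 1)
  have h3 := cycleTrace_eq_of_hom modelN Polynomial.X
    ((ModelRing.val r).comp (UniversalGl.modelEval r : PolyRing →+* ModelRing r)) hνN hD h1 h2 0
  rw [List.length_ofFn] at h3
  rw [Nat.succPNat_coe, ← hw.cyclic, Nat.succPNat_coe, hw.modelEval, ModelRing.val_modelWeight,
    finWeight, viaFintypeEmbedding_finRotate]
  refine Eq.trans ?_ h3
  rw [List.ofFn_succ] at h1 h2 ⊢
  rw [cycleTrace_cons_zero _ _ h1 h2]

end ModelRing

end UniversalGl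

/-! ### Inversion of permutations. -/

namespace UniversalGl

open Equiv

theorem deletePoint_inv {n : ℕ} (j : Fin (n + 1)) (β : Perm (Fin (n + 1))) :
    deletePoint j β⁻¹ = (deletePoint j β)⁻¹ := rfl

theorem swap_succAbove_succ {n : ℕ} (k i : Fin n) :
    swap k.castSucc k.succ (k.succ.succAbove i) = k.castSucc.succAbove i := by
  rcases lt_trichotomy i k with h | rfl | h
  · rw [Fin.succAbove_of_castSucc_lt _ _ (Fin.castSucc_lt_succ_iff.2 h.le),
      Fin.succAbove_of_castSucc_lt _ _ (Fin.castSucc_lt_castSucc_iff.2 h)]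
    exact swap_apply_of_ne_of_ne (fun he => h.ne (Fin.castSucc_injective _ he))
      (Fin.castSucc_lt_succ_iff.2 h.le).ne
  · simp
  · rw [Fin.succAbove_of_le_castSucc _ _ (Fin.succ_le_castSucc_iff.2 h),
      Fin.succAbove_of_le_castSucc _ _ (Fin.castSucc_le_castSucc_iff.2 h.le)]
    exact swap_apply_of_ne_of_ne (Fin.castSucc_lt_succ_iff.2 h.le).ne'
      fun he => h.ne' (Fin.succ_injective _ he)

theorem deletePoint_succ_conj {n : ℕ} (k : Fin n) (β : Perm (Fin (n + 1))) :
    deletePoint k.succ (swap k.castSucc k.succ * β * swap k.castSucc k.succ) =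
      deletePoint k.castSucc β := by
  ext1 i
  refine k.castSucc.succAbove_right_injective ?_
  rw [← swap_succAbove_succ, deletePoint_apply, deletePoint_apply]
  simp only [Perm.mul_apply, swap_succAbove_succ, swap_apply_right]
  simp only [swap_apply_eq_iff, swap_apply_right]
  split_ifs <;> rfl

theorem loopWeight_succ_conj {B : Type*} [CommRing B] (ν : B) {n : ℕ} (k : Fin n)
    (β : Perm (Fin (n + 1))) :
    loopWeight ν k.succ (swap k.castSucc k.succ * β * swap k.castSucc k.succ) =
      loopWeight ν k.castSucc β := by
  simp only [loopWeight, Perm.mul_apply, swap_apply_eq_iff, swap_apply_right]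

theorem loopWeight_inv {B T : Type*} [CommRing B] [DecidableEq T] (ν : B) (j : T) (β : Perm T) :
    loopWeight ν j β⁻¹ = loopWeight ν j β := by
  have h : β⁻¹ j = j ↔ β j = j := by rw [Perm.inv_eq_iff_eq, eq_comm]
  simp only [loopWeight, h]

theorem concat_inv {m n : ℕ} (α : Perm (Fin m)) (β : Perm (Fin n)) :
    (concat α β)⁻¹ = concat α⁻¹ β⁻¹ := rfl

/-- Inverting permutations turns a weight system into a weight system, up to sign. -/
theorem IsWeightSystem.inv {B : Type*} [CommRing B] {ν : B} {W : (m : ℕ) → Perm (Fin m) → B}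
    (hW : IsWeightSystem ν W) : IsWeightSystem ν fun m α => (-1) ^ m * W m α⁻¹ where
  unit := by rw [inv_one, hW.unit, pow_zero, mul_one]
  multiplicative m n α β := by
    rw [concat_inv, hW.multiplicative, pow_add]
    ring
  recurrence n α k := by
    intro s
    have h := hW.recurrence n α⁻¹ k
    have hs : s⁻¹ = s := swap_inv _ _
    -- Inverting `α * s` gives `α⁻¹ * s` conjugated by `s`, so the roles of the two deleted points
    -- are exchanged. This reverses the right side, and the sign is absorbed by the passage from `n
    -- + 1` to `n` points.
    have h0 : (α * s)⁻¹ = s * (α⁻¹ * s) * s := by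
      rw [mul_inv_rev, hs, mul_assoc, mul_assoc, swap_mul_self, mul_one]
    have h1 : (s * α * s)⁻¹ = s * α⁻¹ * s := by
      rw [mul_inv_rev, mul_inv_rev, hs, mul_assoc]
    have h2 : s * (α * s)⁻¹ * s = α⁻¹ * s := by
      rw [mul_inv_rev, hs, ← mul_assoc, swap_mul_self, one_mul]
    have h3 : deletePoint k.succ (α * s)⁻¹ = deletePoint k.castSucc (α⁻¹ * s) := by
      rw [h0, deletePoint_succ_conj]
    have h4 : deletePoint k.castSucc (α * s)⁻¹ = deletePoint k.succ (α⁻¹ * s) := by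
      rw [← h2, deletePoint_succ_conj]
    have h5 : loopWeight ν k.succ (α * s) = loopWeight ν k.castSucc (α⁻¹ * s) := by
      rw [← loopWeight_inv, h0, loopWeight_succ_conj]
    have h6 : loopWeight ν k.castSucc (α * s) = loopWeight ν k.succ (α⁻¹ * s) := by
      rw [← loopWeight_inv, ← h2, loopWeight_succ_conj]
    rw [← deletePoint_inv, ← deletePoint_inv, h1, h3, h4, h5, h6, pow_succ]
    linear_combination -(-1) ^ n * h

theorem neg_one_pow_mul_self (m : ℕ) : (-1 : PolyRing) ^ m * (-1) ^ m = 1 := by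
  rw [← mul_pow, show (-1 : PolyRing) * -1 = 1 by ring, one_pow]

/-- The values of a weight system at inverses are determined by those at inverses of cycles. -/
theorem IsGlWeightSystem.inv_eq_aeval {w : (m : ℕ) → Perm (Fin m) → PolyRing}
    (hw : IsGlWeightSystem w) (m : ℕ) (α : Perm (Fin m)) :
    w m α⁻¹ = (-1) ^ m *
      MvPolynomial.aeval (fun k : ℕ+ => (-1) ^ (k : ℕ) * invCycle w k) (w m α) := by
  have h := hw.eq_aeval hw.isWeightSystem.inv m α
  have h1 : (fun k : ℕ+ => (-1) ^ (k : ℕ) * invCycle w k) =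
      fun k : ℕ+ => (-1) ^ (k : ℕ) * w k (finRotate k)⁻¹ := by
    funext k
    rw [invCycle, if_neg k.ne_zero]
  rw [h1, ← h, ← mul_assoc, neg_one_pow_mul_self, one_mul]

/-- By `inv_eq_aeval` both sides are algebra homomorphisms applied to `w m α`, up to the same sign,
so it suffices to compare them on the Casimirs. -/
theorem IsGlWeightSystem.schurSubstitution_inv {w : (m : ℕ) → Perm (Fin m) → PolyRing}
    (hw : IsGlWeightSystem w)
    (h : ∀ k : ℕ+, schurSubstitution (invCycle w k) =
      (-1) ^ (k : ℕ) * signSubstitution (schurSubstitution (MvPolynomial.X k)))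
    (m : ℕ) (α : Perm (Fin m)) :
    schurSubstitution (w m α⁻¹) = (-1) ^ m * signSubstitution (schurSubstitution (w m α)) := by
  have h1 : schurSubstitution.comp
      (MvPolynomial.aeval fun k : ℕ+ => (-1) ^ (k : ℕ) * invCycle w k) =
        signSubstitution.comp schurSubstitution := by
    refine MvPolynomial.algHom_ext fun k => ?_
    rw [AlgHom.comp_apply, MvPolynomial.aeval_X, map_mul, h, ← mul_assoc, map_pow, map_neg, map_one,
      neg_one_pow_mul_self, one_mul, AlgHom.comp_apply]
  rw [hw.inv_eq_aeval, map_mul, map_pow, map_neg, map_one]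
  exact congrArg _ (DFunLike.congr_fun h1 (w m α))

end UniversalGl

/-! ### Power series: substitution, formal powers, and the generating function of the recursion. -/

namespace UniversalGl

open PowerSeries

section SubstHom

variable {A : Type*} [CommRing A]

/-- Substitution of a series without constant term, as a homomorphism. -/
noncomputable def substHom (g : PowerSeries A) (hg : constantCoeff g = 0) :
    PowerSeries A →ₐ[A] PowerSeries A :=
  substAlgHom (HasSubst.of_constantCoeff_zero' hg)

variable (g : PowerSeries A) (hg : constantCoeff g = 0)

theorem substHom_apply (f : PowerSeries A) : substHom g hg f = f.subst g := by
  rw [substHom, coe_substAlgHom]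

theorem substHom_X : substHom g hg X = g := by
  rw [substHom_apply, subst_X (HasSubst.of_constantCoeff_zero' hg)]

theorem substHom_C (a : A) : substHom g hg (C a) = C a :=
  (substHom g hg).commutes a

theorem constantCoeff_substHom (f : PowerSeries A) :
    constantCoeff (substHom g hg f) = constantCoeff f := by
  have h : f = C (constantCoeff f) + (f - C (constantCoeff f)) := by ring
  rw [h, map_add, map_add, substHom_C, substHom_apply]
  have h0 : constantCoeff ((f - C (constantCoeff f)).subst g) = 0 :=
    constantCoeff_subst_eq_zero hg _ (by simp)
  rw [h0]
  simp

theorem derivative_substHom (f : PowerSeries A) :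
    derivative A (substHom g hg f) = substHom g hg (derivative A f) * derivative A g := by
  rw [substHom_apply, substHom_apply, derivative_subst (HasSubst.of_constantCoeff_zero' hg)]

theorem substHom_substHom {g' : PowerSeries A} (hg' : constantCoeff g' = 0) {g'' : PowerSeries A}
    (hg'' : constantCoeff g'' = 0) (h : substHom g hg g' = g'') (f : PowerSeries A) :
    substHom g hg (substHom g' hg' f) = substHom g'' hg'' f := by
  subst h
  simp only [substHom_apply]
  exact subst_comp_subst_apply (HasSubst.of_constantCoeff_zero' hg')
    (HasSubst.of_constantCoeff_zero' hg) f

theorem map_substHom {B : Type*} [CommRing B] (φ : A →+* B) (f : PowerSeries A)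
    (hg' : constantCoeff (PowerSeries.map φ g) = 0) :
    PowerSeries.map φ (substHom g hg f) =
      substHom (PowerSeries.map φ g) hg' (PowerSeries.map φ f) := by
  rw [substHom_apply, substHom_apply]
  exact map_subst (HasSubst.of_constantCoeff_zero' hg) f

theorem coeff_one_eq_derivative (f : PowerSeries A) :
    coeff 1 f = constantCoeff (derivative A f) := by
  rw [← coeff_zero_eq_constantCoeff_apply, coeff_derivative]
  simp

theorem coeff_one_substHom (f : PowerSeries A) :
    coeff 1 (substHom g hg f) = coeff 1 f * coeff 1 g := by
  simp only [coeff_one_eq_derivative, derivative_substHom, map_mul, constantCoeff_substHom]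

end SubstHom

section IsPower

variable {A : Type*} [CommRing A]

/-- The characterization of the power `P = f ^ r` of a series with constant term `1` by a
differential equation. -/
structure IsPower (f : PowerSeries A) (r : A) (P : PowerSeries A) : Prop where
  constantCoeff_eq : constantCoeff P = 1
  derivative_eq : f * derivative A P = C r * derivative A f * P

variable {f g : PowerSeries A} {r : A} {P Q : PowerSeries A}

theorem IsPower.mul (hP : IsPower f r P) (hQ : IsPower g r Q) : IsPower (f * g) r (P * Q) where
  constantCoeff_eq := by rw [map_mul, hP.constantCoeff_eq, hQ.constantCoeff_eq, one_mul]
  derivative_eq := by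
    have h1 := hP.derivative_eq
    have h2 := hQ.derivative_eq
    simp only [Derivation.leibniz, smul_eq_mul]
    linear_combination g * Q * h1 + f * P * h2

theorem IsPower.substHom (hP : IsPower f r P) (v : PowerSeries A) (hv : constantCoeff v = 0) :
    IsPower (substHom v hv f) r (substHom v hv P) where
  constantCoeff_eq := by rw [constantCoeff_substHom, hP.constantCoeff_eq]
  derivative_eq := by
    have h := congrArg (UniversalGl.substHom v hv) hP.derivative_eq
    simp only [map_mul, substHom_C] at h
    rw [derivative_substHom, derivative_substHom]
    linear_combination derivative A v * h

theorem derivative_map {B : Type*} [CommRing B] (φ : A →+* B) (f : PowerSeries A) :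
    derivative B (PowerSeries.map φ f) = PowerSeries.map φ (derivative A f) := by
  ext n
  simp [coeff_derivative]

theorem IsPower.map {B : Type*} [CommRing B] (hP : IsPower f r P) (φ : A →+* B) :
    IsPower (PowerSeries.map φ f) (φ r) (PowerSeries.map φ P) where
  constantCoeff_eq := by
    rw [← coeff_zero_eq_constantCoeff_apply, coeff_map, coeff_zero_eq_constantCoeff_apply,
      hP.constantCoeff_eq, map_one]
  derivative_eq := by
    have h := congrArg (PowerSeries.map φ) hP.derivative_eq
    rw [map_mul, map_mul, map_mul, PowerSeries.map_C] at h
    rw [derivative_map, derivative_map, h]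

/-- The equation reduces to `P' = 0`. With `IsPower.mul` it shows that powers of mutually inverse
series are mutually inverse. -/
theorem IsPower.eq_one [IsAddTorsionFree A] (hP : IsPower 1 r P) : P = 1 := by
  refine derivative.ext ?_ (by rw [hP.constantCoeff_eq, map_one])
  have h := hP.derivative_eq
  rwa [one_mul, Derivation.map_one_eq_zero, mul_zero, zero_mul,
    ← Derivation.map_one_eq_zero (derivative A)] at h

theorem IsPower.coeff_one (hP : IsPower f r P) (hf : constantCoeff f = 1) :
    coeff 1 P = r * coeff 1 f := by
  have h := congrArg constantCoeff hP.derivative_eq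
  rwa [map_mul, map_mul, map_mul, hf, hP.constantCoeff_eq, one_mul, mul_one, constantCoeff_C,
    ← coeff_one_eq_derivative, ← coeff_one_eq_derivative] at h

theorem isPower_binomialSeries [BinomialRing A] (r : A) :
    IsPower (1 + X) r (binomialSeries A r) where
  constantCoeff_eq := binomialSeries_constantCoeff r
  derivative_eq := by
    -- This is the coefficient form of `(1 + X) P' = r P`.
    have hc : ∀ n : ℕ, Ring.choose r (n + 1) * (n + 1) = Ring.choose r n * (r - n) := by
      intro n
      have h := Ring.choose_smul_choose r (Nat.le_succ n)
      rw [Nat.succ_eq_add_one, Nat.choose_succ_self_right, Nat.add_sub_cancel_left,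
        Ring.choose_one_right, nsmul_eq_mul] at h
      rw [← h]
      push_cast
      ring
    rw [map_add, derivative_X, Derivation.map_one_eq_zero, zero_add, mul_one, add_mul, one_mul]
    ext n
    cases n with
    | zero =>
      rw [map_add, coeff_zero_X_mul, coeff_zero_eq_constantCoeff_apply, ← coeff_one_eq_derivative]
      simp
    | succ n =>
      have h := hc (n + 1)
      rw [map_add, coeff_succ_X_mul, coeff_C_mul]
      simp only [coeff_derivative, binomialSeries_coeff, smul_eq_mul, mul_one]
      push_cast at h ⊢
      linear_combination h

end IsPower

theorem isPower_formalPow {f : PowerSeries PolyRing} (hf : constantCoeff f = 1) (r : PolyRing) :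
    IsPower f r (formalPow f r) := by
  have h0 : constantCoeff (f - 1) = 0 := by rw [map_sub, hf, map_one, sub_self]
  have h := (isPower_binomialSeries r).substHom (f - 1) h0
  rw [map_add, map_one, substHom_X, add_sub_cancel, substHom_apply] at h
  exact h

/-- A generating function identity equivalent to the recursion defining `cyclePoly`. -/
theorem mul_substHom_eq_one {A : Type*} [CommRing A] (ν : A) (d : ℕ → A) (F : PowerSeries A)
    (h0 : constantCoeff F = 1) (hF : ∀ a, coeff (a + 1) F = -cyclePoly ν d a 0)
    (v : PowerSeries A) (hv : constantCoeff v = 0) (huv : (1 + C ν * X) * v = X) :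
    (1 + X * mk d) * substHom v hv F = 1 := by
  -- `G a` collects the values over the exponent `k`, and `R n` is the tail of `F` from degree `n +
  -- 1` on.
  let G : ℕ → PowerSeries A := fun a => mk (cyclePoly ν d a)
  let R : ℕ → PowerSeries A := fun n => mk fun i => coeff (i + n + 1) F
  have hR0 : F = 1 + X * R 0 := by
    ext n
    cases n with
    | zero => simp [h0]
    | succ n => simp [R, coeff_succ_X_mul, coeff_one]
  have hR : ∀ n, R n = -C (cyclePoly ν d n 0) + X * R (n + 1) := by
    intro n
    ext i
    cases i with
    | zero => simp [R, hF]
    | succ i => simp [R, coeff_succ_X_mul, add_assoc, add_comm, add_left_comm]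
  have hG : ∀ a, X * G (a + 1) = (1 + C ν * X) * G a -
      C (cyclePoly ν d a 0) * (1 + X * mk d) := by
    intro a
    ext i
    cases i with
    | zero => simp [G]
    | succ i =>
      rw [coeff_succ_X_mul, add_mul, mul_assoc, map_sub, map_add, one_mul, coeff_C_mul, coeff_C_mul,
        coeff_succ_X_mul, map_add, coeff_succ_X_mul, coeff_one, if_neg (Nat.succ_ne_zero i)]
      simp only [G, coeff_mk, cyclePoly]
      ring
  -- Since `X = (1 + ν X) v`, each use of the recursion extracts one more factor `v`. The error is
  -- thus divisible by every power of `X`, hence zero.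
  have key : ∀ n, (1 + X * mk d) * substHom v hv F - 1 =
      v ^ (n + 1) * ((1 + X * mk d) * substHom v hv (R n) + (1 + C ν * X) * G n) := by
    intro n
    induction n with
    | zero =>
      have hG0 : G 0 = mk d := rfl
      rw [hR0, map_add, map_one, map_mul, substHom_X, hG0]
      linear_combination mk d * (-huv)
    | succ n ih =>
      rw [ih, hR n, map_add, map_neg, map_mul, substHom_X, substHom_C]
      linear_combination -v ^ (n + 1) * hG n - v ^ (n + 1) * G (n + 1) * huv
  rw [← sub_eq_zero]
  ext n
  have hX : X ^ (n + 1) ∣ (1 + X * mk d) * substHom v hv F - 1 := by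
    rw [key n]
    exact (pow_dvd_pow_of_dvd (X_dvd_iff.2 hv) _).mul_right _
  rw [X_pow_dvd_iff.1 hX n n.lt_succ_self, map_zero]

end UniversalGl

/-! ### The functional equation of the Casimir series in Schur form. -/

namespace UniversalGl

open PowerSeries

theorem one_sub_mul_geometric (a : PolyRing) : (1 - C a * X) * geometric a = 1 := by
  ext1 n
  cases n with
  | zero => simp [geometric]
  | succ n =>
    rw [sub_mul, one_mul, mul_assoc, map_sub, coeff_C_mul, coeff_succ_X_mul, coeff_one,
      if_neg (Nat.succ_ne_zero n), geometric, coeff_mk, coeff_mk, pow_succ]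
    ring

theorem constantCoeff_geometric (a : PolyRing) : constantCoeff (geometric a) = 1 := by
  rw [← coeff_zero_eq_constantCoeff_apply, geometric, coeff_mk, pow_zero]

theorem constantCoeff_X_mul (f : PowerSeries PolyRing) : constantCoeff (X * f) = 0 := by simp

/-- The Möbius transformation `(1 - (N+1)u/2) / (1 - (N-1)u/2)`. -/
noncomputable def moebius : PowerSeries PolyRing :=
  (1 - C halfSucc * X) * geometric halfPred

theorem constantCoeff_moebius : constantCoeff moebius = 1 := by
  simp [moebius, constantCoeff_geometric]

theorem N_sub_halfPred : N - halfPred = halfSucc := by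
  have h : (N : PolyRing) = (1 / 2 : ℂ) • N + (1 / 2 : ℂ) • N := by
    rw [← add_smul]
    norm_num
  rw [halfPred, halfSucc, smul_sub, smul_add]
  linear_combination h

theorem halfSucc_sub_halfPred : halfSucc - halfPred = 1 := by
  rw [halfPred, halfSucc, ← smul_sub, add_sub_sub_cancel, ← two_smul ℂ (1 : PolyRing), smul_smul]
  norm_num

/-- The series `X / (1 + N X)`. -/
noncomputable def twist : PowerSeries PolyRing := X * geometric (-N)

theorem twist_eq : (1 + C N * X) * twist = X := by
  have h := one_sub_mul_geometric (-N)
  rw [map_neg] at h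
  rw [twist]
  linear_combination X * h

theorem constantCoeff_twist : constantCoeff twist = 0 := constantCoeff_X_mul _

theorem ne_zero_of_constantCoeff {f : PowerSeries PolyRing} (hf : constantCoeff f = 1) : f ≠ 0 := by
  rintro rfl
  simp at hf

theorem constantCoeff_neg_X : constantCoeff (-X : PowerSeries PolyRing) = 0 := by simp

/-- The substitution `u ↦ -u`. -/
noncomputable abbrev negHom : PowerSeries PolyRing →ₐ[PolyRing] PowerSeries PolyRing :=
  substHom (-X) constantCoeff_neg_X

/-- The substitution `u ↦ u / (1 + N u)`. -/
noncomputable abbrev twistHom : PowerSeries PolyRing →ₐ[PolyRing] PowerSeries PolyRing :=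
  substHom twist constantCoeff_twist

theorem negHom_eq_rescale (f : PowerSeries PolyRing) : negHom f = rescale (-1) f := by
  rw [substHom_apply, rescale_eq_subst, neg_one_smul]

theorem one_add_mul_ne_zero (a : PolyRing) : (1 + C a * X : PowerSeries PolyRing) ≠ 0 :=
  ne_zero_of_constantCoeff (by simp)

/-- With `a = (N-1)/2`, `b = (N+1)/2` and `a + b = N`, the factors are `(1+bu)/(1+au)` and
`(1+Nu-bu)/(1+Nu-au) = (1+au)/(1+bu)`. -/
theorem negHom_moebius_mul_twistHom_moebius : negHom moebius * twistHom moebius = 1 := by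
  have h0 : (1 - C halfPred * X) * moebius = 1 - C halfSucc * X := by
    rw [moebius]
    linear_combination (1 - C halfSucc * X) * one_sub_mul_geometric halfPred
  have h1 := congrArg negHom h0
  have h2 := congrArg twistHom h0
  simp only [map_mul, map_sub, map_one, substHom_X, substHom_C] at h1 h2
  have hN : (C N : PowerSeries PolyRing) = C halfPred + C halfSucc := by
    rw [← map_add, ← N_sub_halfPred, add_sub_cancel]
  have ht := twist_eq
  have h3 : (1 + C halfSucc * X) * twistHom moebius = 1 + C halfPred * X := by
    rw [hN] at ht
    linear_combination (1 + (C halfPred + C halfSucc) * X) * h2 +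
      (C halfPred * twistHom moebius - C halfSucc) * ht
  refine mul_left_cancel₀ (mul_ne_zero (one_add_mul_ne_zero halfPred)
    (one_add_mul_ne_zero halfSucc)) ?_
  linear_combination (1 + C halfSucc * X) * twistHom moebius * h1 + (1 + C halfSucc * X) * h3

/-- Both sides are `u/(1+bu)`, since replacing `u` by `u/(1+Nu)` in `u/(1-au)` gives `u/(1+(N-a)u)`.
-/
theorem twistHom_X_mul_geometric {a b : PolyRing} (h : N = a + b) :
    twistHom (X * geometric a) = -negHom (X * geometric b) := by
  have h1 := congrArg (fun f => twistHom (X * f)) (one_sub_mul_geometric a)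
  have h2 := congrArg (fun f => negHom (X * f)) (one_sub_mul_geometric b)
  simp only [map_mul, map_sub, map_one, substHom_X, substHom_C] at h1 h2 ⊢
  have ht := twist_eq
  rw [h, map_add] at ht
  refine mul_left_cancel₀ (one_add_mul_ne_zero b) ?_
  linear_combination (1 + (C a + C b) * X) * h1 + (C a * twist * twistHom (geometric a) + 1) * ht + h2

/-- The substitution `S_i ↦ (-1) ^ i S_i` as a ring homomorphism. -/
noncomputable abbrev signHom : PolyRing →+* PolyRing := signSubstitution

theorem signHom_N : signHom N = N := by
  simp [signSubstitution, N]

theorem signHom_smul (a : ℂ) (p : PolyRing) : signHom (a • p) = a • signHom p := by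
  rw [← algebraMap_smul (Polynomial ℂ) a p, ← algebraMap_smul (Polynomial ℂ) a]
  exact map_smul signSubstitution _ _

theorem signHom_halfPred : signHom halfPred = halfPred := by
  rw [halfPred, signHom_smul, map_sub, signHom_N, map_one]

theorem signHom_halfSucc : signHom halfSucc = halfSucc := by
  rw [halfSucc, signHom_smul, map_add, signHom_N, map_one]

theorem map_geometric {a : PolyRing} (ha : signHom a = a) :
    PowerSeries.map signHom (geometric a) = geometric a := by
  ext1 n
  rw [coeff_map, geometric, coeff_mk, map_pow, ha]

theorem map_moebius : PowerSeries.map signHom moebius = moebius := by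
  rw [moebius, map_mul, map_geometric signHom_halfPred, map_sub, map_mul, PowerSeries.map_C,
    PowerSeries.map_X, signHom_halfSucc, map_one]

theorem map_schurSeries : PowerSeries.map signHom schurSeries = negHom schurSeries := by
  rw [negHom_eq_rescale]
  ext1 n
  rw [coeff_map, coeff_rescale, schurSeries, coeff_mk]
  split_ifs with h
  · exact MvPolynomial.aeval_X _ _
  · obtain rfl : n = 0 := by omega
    simp

theorem shiftedSchurSeries_eq (a : PolyRing) :
    shiftedSchurSeries a = substHom (X * geometric a) (constantCoeff_X_mul _) schurSeries := by
  rw [substHom_apply, shiftedSchurSeries]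

theorem constantCoeff_schurSeries : constantCoeff schurSeries = 1 := by
  rw [← coeff_zero_eq_constantCoeff_apply, schurSeries, coeff_mk, dif_neg (lt_irrefl 0)]

theorem constantCoeff_shiftedSchurSeries (a : PolyRing) :
    constantCoeff (shiftedSchurSeries a) = 1 := by
  rw [shiftedSchurSeries_eq, constantCoeff_substHom, constantCoeff_schurSeries]

/-- Changing the signs of `S_i` changes the sign of the argument of the Schur series, so both sides
are that series at `u/(1+au)`. The shifts `(N-1)/2` and `(N+1)/2` are thereby exchanged. -/
theorem negHom_map_shiftedSchurSeries {a b : PolyRing} (ha : signHom a = a) (h : N = b + a) :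
    negHom (PowerSeries.map signHom (shiftedSchurSeries a)) =
      twistHom (shiftedSchurSeries b) := by
  have hq : PowerSeries.map signHom (X * geometric a) = X * geometric a := by
    rw [map_mul, PowerSeries.map_X, map_geometric ha]
  have h0 : constantCoeff (twistHom (X * geometric b)) = 0 := by
    rw [constantCoeff_substHom, constantCoeff_X_mul]
  have h1 : constantCoeff (negHom (X * geometric a)) = 0 := by
    rw [constantCoeff_substHom, constantCoeff_X_mul]
  rw [shiftedSchurSeries_eq, shiftedSchurSeries_eq, substHom_substHom _ _ _ h0 rfl,
    map_substHom _ _ _ _ (by rw [hq, constantCoeff_X_mul]), map_schurSeries]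
  simp only [hq]
  rw [substHom_substHom _ _ _ h1 rfl]
  refine substHom_substHom _ _ _ h0 ?_ _
  rw [map_neg, substHom_X, twistHom_X_mul_geometric h]

theorem casimirSeries_mul :
    casimirSeries * shiftedSchurSeries halfSucc =
      formalPow moebius N * shiftedSchurSeries halfPred := by
  have h : shiftedSchurSeries halfSucc * invOfUnit (shiftedSchurSeries halfSucc) 1 = 1 :=
    mul_invOfUnit _ _ (by rw [constantCoeff_shiftedSchurSeries, Units.val_one])
  rw [casimirSeries, ← moebius]
  linear_combination formalPow moebius N * shiftedSchurSeries halfPred * h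

theorem constantCoeff_casimirSeries : constantCoeff casimirSeries = 1 := by
  have h := congrArg constantCoeff casimirSeries_mul
  rwa [map_mul, map_mul, constantCoeff_shiftedSchurSeries, constantCoeff_shiftedSchurSeries,
    (isPower_formalPow constantCoeff_moebius N).constantCoeff_eq, mul_one, mul_one] at h

theorem coeff_one_shiftedSchurSeries (a : PolyRing) :
    coeff 1 (shiftedSchurSeries a) = coeff 1 schurSeries := by
  rw [shiftedSchurSeries_eq, coeff_one_substHom, coeff_one_mul]
  simp [constantCoeff_geometric]

theorem coeff_one_casimirSeries : coeff 1 casimirSeries = -N := by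
  have h := congrArg (coeff 1) casimirSeries_mul
  have hm : coeff 1 moebius = -1 := by
    rw [moebius, coeff_one_mul, constantCoeff_geometric]
    have : coeff 1 (geometric halfPred) = halfPred := by rw [geometric, coeff_mk, pow_one]
    rw [this]
    simp [coeff_one]
    linear_combination -halfSucc_sub_halfPred
  rw [coeff_one_mul, coeff_one_mul, constantCoeff_shiftedSchurSeries,
    constantCoeff_shiftedSchurSeries, coeff_one_shiftedSchurSeries, coeff_one_shiftedSchurSeries,
    (isPower_formalPow constantCoeff_moebius N).constantCoeff_eq,
    (isPower_formalPow constantCoeff_moebius N).coeff_one constantCoeff_moebius, hm,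
    constantCoeff_casimirSeries] at h
  linear_combination h

/-- The two quotients of Schur series are reciprocal because the shifts are exchanged, and the two
`N`-th powers are reciprocal because their bases are. -/
theorem negHom_map_mul_twistHom_casimirSeries :
    negHom (PowerSeries.map signHom casimirSeries) * twistHom casimirSeries = 1 := by
  have hP := isPower_formalPow constantCoeff_moebius N
  have hP1 := (hP.map signHom).substHom (-X) constantCoeff_neg_X
  rw [map_moebius, signHom_N] at hP1
  have hP2 := hP1.mul (hP.substHom twist constantCoeff_twist)
  rw [negHom_moebius_mul_twistHom_moebius] at hP2
  have h0 := hP2.eq_one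
  have h1 := congrArg (fun f => negHom (PowerSeries.map signHom f)) casimirSeries_mul
  have h2 := congrArg twistHom casimirSeries_mul
  have hN : N = halfPred + halfSucc := by rw [← N_sub_halfPred, add_sub_cancel]
  simp only [map_mul, negHom_map_shiftedSchurSeries signHom_halfSucc hN,
    negHom_map_shiftedSchurSeries signHom_halfPred (hN.trans (add_comm _ _))] at h1 h2
  have hne : ∀ a, twistHom (shiftedSchurSeries a) ≠ 0 := fun a =>
    ne_zero_of_constantCoeff (by rw [constantCoeff_substHom, constantCoeff_shiftedSchurSeries])
  refine mul_left_cancel₀ (mul_ne_zero (hne halfPred) (hne halfSucc)) ?_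
  linear_combination twistHom casimirSeries * twistHom (shiftedSchurSeries halfSucc) * h1 +
    negHom (PowerSeries.map signHom (formalPow moebius N)) *
      twistHom (shiftedSchurSeries halfSucc) * h2 +
    twistHom (shiftedSchurSeries halfSucc) * twistHom (shiftedSchurSeries halfPred) * h0

theorem map_cyclePoly {A B : Type*} [CommRing A] [CommRing B] (φ : A →+* B) (ν : A) (d : ℕ → A)
    (a k : ℕ) : φ (cyclePoly ν d a k) = cyclePoly (φ ν) (fun j => φ (d j)) a k := by
  induction a generalizing k with
  | zero => rfl
  | succ a ih => simp only [cyclePoly, map_sub, map_add, map_mul, ih]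

theorem IsGlWeightSystem.schurSubstitution_invCycle {w : (m : ℕ) → Equiv.Perm (Fin m) → PolyRing}
    (hw : IsGlWeightSystem w) (k : ℕ+) : schurSubstitution (invCycle w k) =
      (-1) ^ (k : ℕ) * signSubstitution (schurSubstitution (MvPolynomial.X k)) := by
  let d : ℕ → PolyRing := fun j => schurSubstitution (invCycle w j)
  have hsN : schurSubstitution N = N := by simp [schurSubstitution, N]
  have hF : ∀ a, coeff (a + 1) casimirSeries = -cyclePoly N d a 0 := by
    intro a
    cases a with
    | zero =>
      rw [zero_add, coeff_one_casimirSeries, cyclePoly]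
      simp only [d, invCycle, if_pos, hsN]
    | succ a =>
      have h := congrArg schurSubstitution (hw.X_eq_cyclePoly a.succPNat)
      have h1 := map_cyclePoly (schurSubstitution : PolyRing →+* PolyRing) N (invCycle w) (a + 1) 0
      simp only [RingHom.coe_coe, hsN] at h1
      rw [Nat.succPNat_coe, Nat.succ_eq_add_one, h1, schurSubstitution, MvPolynomial.aeval_X,
        Nat.succPNat_coe] at h
      exact neg_eq_iff_eq_neg.1 h
  have h1 := mul_substHom_eq_one N d casimirSeries constantCoeff_casimirSeries hF twist
    constantCoeff_twist twist_eq
  -- Both series are inverse to `twistHom casimirSeries`; the coefficient of degree `k + 1` then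
  -- gives the claim.
  have h2 : negHom (PowerSeries.map signHom casimirSeries) = 1 + X * PowerSeries.mk d :=
    mul_right_cancel₀ (right_ne_zero_of_mul_eq_one h1)
      (negHom_map_mul_twistHom_casimirSeries.trans h1.symm)
  have h3 := congrArg (coeff ((k : ℕ) + 1)) h2
  rw [negHom_eq_rescale, coeff_rescale, coeff_map, map_add, coeff_succ_X_mul, coeff_one,
    if_neg (Nat.succ_ne_zero _), zero_add, coeff_mk] at h3
  have h4 : schurSubstitution (MvPolynomial.X k) = -coeff ((k : ℕ) + 1) casimirSeries :=
    MvPolynomial.aeval_X _ _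
  rw [h4, map_neg]
  refine h3.symm.trans ?_
  rw [pow_succ, RingHom.coe_coe]
  ring

end UniversalGl

theorem mainTheorem3 :
    (∃! w : (m : ℕ) → Equiv.Perm (Fin m) → UniversalGl.PolyRing, UniversalGl.IsGlWeightSystem w) ∧
    ∀ w : (m : ℕ) → Equiv.Perm (Fin m) → UniversalGl.PolyRing, UniversalGl.IsGlWeightSystem w →
      ∀ (m : ℕ) (α : Equiv.Perm (Fin m)),
        UniversalGl.schurSubstitution (w m α⁻¹) =
          (-1) ^ m * UniversalGl.signSubstitution (UniversalGl.schurSubstitution (w m α)) := by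
  refine ⟨?_, fun w hw => hw.schurSubstitution_inv hw.schurSubstitution_invCycle⟩
  obtain ⟨w, hw⟩ := UniversalGl.exists_isGlWeightSystem
  exact ⟨w, hw, fun w' hw' => hw'.ext hw⟩
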